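/- Let $N\ge 1$, $1<p<\infty$, $p'=p/(p-1)$, let $\Omega\subset\mathbb{R}^N$ be bounded and open, and let $k$ be a positive function on $(0,\infty)$ such that $z\mapsto k(|z|)$ is locally integrable on $\mathbb{R}^N$, $\int_{\mathbb{R}^N\setminus B(0,\epsilon)}k(|z|)|z|^{-p}\,dz<\infty$ for every $\epsilon>0$, and, for some $c_0>0$, $s\in(0,1)$, $r_0>0$, $k(|z|)\ge c_0|z|^{-(N+(s-1)p)}$ whenever $0<|z|<r_0$. Put $$B(u,u)=\iint_{\mathbb{R}^N\times\mathbb{R}^N}k(|x'-x|)\frac{|u(x')-u(x)|^p}{|x'-x|^p}\,dx'dx,$$ $X_0=\{u\in L^p(\mathbb{R}^N): B(u,u)<\infty,\ u=0\text{ a.e. in }\mathbb{R}^N\setminus\Omega\}$ with norm $\|u\|_{X_0}=B(u,u)^{1/p}$, and let $X_0'$ be its dual. Let $0<h_{\min}<h_{\max}$ and let $\mathcal{H}$ be the set of measurable $h$ on $\mathbb{R}^N\times\mathbb{R}^N$ with $h(x',x)=h(x,x')\in[h_{\min},h_{\max}]$ a.e. For $h\in\mathcal{H}$ and $f\in X_0'$,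 $u=\mathcal{L}_h^{-1}f$ means that $u\in X_0$ and $$\iint h(x',x)\,k(|x'-x|)\frac{|u(x')-u(x)|^{p-2}(u(x')-u(x))(v(x')-v(x))}{|x'-x|^p}\,dx'dx=\langle f,v\rangle\quad\text{for all }v\in X_0,$$ and the corresponding flux is $$\Psi_h(x',x)=h(x',x)\,k(|x'-x|)^{1/p'}\frac{|u(x')-u(x)|^{p-2}(u(x')-u(x))}{|x'-x|^{p-1}}.$$ Let $h_j\in\mathcal{H}$ $(j\in\mathbb{N})$ and $h\in\mathcal{H}$; for $f\in X_0'$ write $u_j=\mathcal{L}_{h_j}^{-1}f$ and $u=\mathcal{L}_h^{-1}f$. Say that $(\mathcal{L}_{h_j})$ $G$-converges to $\mathcal{L}_h$ in the weak (strong) sense if $u_j\to u$ weakly (strongly) in $X_0$ for every $f\in X_0'$, and that it $H$-converges to $\mathcal{L}_h$ if, for every $f\in X_0'$, $u_j\rightharpoonup u$ weakly in $X_0$ and $\Psi_{h_j}\rightharpoonup\Psi_h$ weakly in $L^{p'}(\mathbb{R}^N\times\mathbb{R}^N)$. Then: 1. For every $f\in X_0'$: if $u_j\rightharpoonup u$ weakly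 in $X_0$ and $\Psi_{h_j}\rightharpoonup\Psi_h$ weakly in $L^{p'}(\mathbb{R}^N\times\mathbb{R}^N)$, then $u_j\to u$ strongly in $X_0$ (for the whole sequence). 2. $H$-convergence of $(\mathcal{L}_{h_j})$ to $\mathcal{L}_h$ implies $G$-convergence in the strong sense, and $G$-convergence in the weak sense is equivalent to $G$-convergence in the strong sense. 3. If moreover $h_j\rightharpoonup h$ weakly-$*$ in $L^\infty(\mathbb{R}^N\times\mathbb{R}^N)$, then $H$-convergence, $G$-convergence in the strong sense and $G$-convergence in the weak sense of $(\mathcal{L}_{h_j})$ to $\mathcal{L}_h$ are all equivalent. -/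

import Mathlib

open MeasureTheory Filter Topology Set
open scoped ENNReal

namespace NonlocalPLaplacian

noncomputable section

/-- The ambient space `ℝ^N` with its Euclidean norm. -/
abbrev E (N : ℕ) : Type := EuclideanSpace ℝ (Fin N)

/-- Assumptions on the profile `k` of the radial kernel `z ↦ k(|z|)`: it is positive and locally
integrable, `k(|z|) / |z|^p` is integrable away from the origin, and
`k(|z|) ≥ c₀ / |z|^{N + (s - 1) p}` near the origin, for some `c₀ > 0` and `s ∈ (0, 1)`. -/
structure IsKernel (N : ℕ) (p : ℝ) (k : ℝ → ℝ) : Prop where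
  pos : ∀ r : ℝ, 0 < r → 0 < k r
  locallyIntegrable : LocallyIntegrable (fun z : E N => k ‖z‖)
  tail : ∀ ε : ℝ, 0 < ε →
    IntegrableOn (fun z : E N => k ‖z‖ / ‖z‖ ^ p) (Metric.ball (0 : E N) ε)ᶜ
  lower : ∃ c₀ s r₀ : ℝ, 0 < c₀ ∧ 0 < s ∧ s < 1 ∧ 0 < r₀ ∧
    ∀ z : E N, z ≠ 0 → ‖z‖ < r₀ → c₀ / ‖z‖ ^ ((N : ℝ) + (s - 1) * p) ≤ k ‖z‖

/-- The integrand `k(|x' - x|) |u(x') - u(x)|^p / |x' - x|^p` of the energy, at `z = (x', x)`. -/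
def energyDensity {N : ℕ} (p : ℝ) (k : ℝ → ℝ) (u : E N → ℝ) (z : E N × E N) : ℝ :=
  k ‖z.1 - z.2‖ * |u z.1 - u z.2| ^ p / ‖z.1 - z.2‖ ^ p

/-- The energy `B(u, u) ∈ [0, ∞]`. -/
def energy {N : ℕ} (p : ℝ) (k : ℝ → ℝ) (u : E N → ℝ) : ℝ≥0∞ :=
  ∫⁻ z : E N × E N, ENNReal.ofReal (energyDensity p k u z)

theorem aemeasurable_energyDensity {N : ℕ} {p : ℝ} {k : ℝ → ℝ} (hk : IsKernel N p k)
    {u : E N → ℝ} (hu : AEStronglyMeasurable u) :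
    AEMeasurable (fun z : E N × E N => energyDensity p k u z) := by
  have h1 : AEMeasurable (fun z : E N × E N => u z.1) :=
    (hu.comp_quasiMeasurePreserving Measure.quasiMeasurePreserving_fst).aemeasurable
  have h2 : AEMeasurable (fun z : E N × E N => u z.2) :=
    (hu.comp_quasiMeasurePreserving Measure.quasiMeasurePreserving_snd).aemeasurable
  have h3 : AEMeasurable (fun z : E N × E N => k ‖z.1 - z.2‖) :=
    (hk.locallyIntegrable.aestronglyMeasurable.comp_quasiMeasurePreserving
      (quasiMeasurePreserving_sub (volume : Measure (E N)) volume)).aemeasurable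
  have h4 : AEMeasurable (fun z : E N × E N => ‖z.1 - z.2‖) :=
    (continuous_fst.sub continuous_snd).norm.measurable.aemeasurable
  have h5 : AEMeasurable (fun z : E N × E N => |u z.1 - u z.2|) :=
    continuous_abs.measurable.comp_aemeasurable (h1.sub h2)
  exact (h3.mul (h5.pow_const p)).div (h4.pow_const p)

theorem energyDensity_nonneg {N : ℕ} {p : ℝ} (hp : 1 < p) {k : ℝ → ℝ} (hk : IsKernel N p k)
    (u : E N → ℝ) (z : E N × E N) : 0 ≤ energyDensity p k u z := by
  unfold energyDensity
  rcases (norm_nonneg (z.1 - z.2)).eq_or_lt with h | h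
  · rw [← h, Real.zero_rpow (by linarith), div_zero]
  · have := hk.pos _ h
    positivity

theorem energyDensity_add_le {N : ℕ} {p : ℝ} (hp : 1 < p) {k : ℝ → ℝ} (hk : IsKernel N p k)
    (u v : E N → ℝ) (z : E N × E N) :
    energyDensity p k (u + v) z
      ≤ 2 ^ p * (energyDensity p k u z + energyDensity p k v z) := by
  rcases (norm_nonneg (z.1 - z.2)).eq_or_lt with h | h
  · simp [energyDensity, ← h, Real.zero_rpow (by linarith : p ≠ 0)]
  have hkp := hk.pos _ h
  have key : |(u + v) z.1 - (u + v) z.2| ^ p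
      ≤ 2 ^ p * (|u z.1 - u z.2| ^ p + |v z.1 - v z.2| ^ p) := by
    set a := |u z.1 - u z.2|
    set b := |v z.1 - v z.2|
    have ha : 0 ≤ a := abs_nonneg _
    have hb : 0 ≤ b := abs_nonneg _
    have h1 : |(u + v) z.1 - (u + v) z.2| ≤ 2 * max a b := by
      have : (u + v) z.1 - (u + v) z.2 = (u z.1 - u z.2) + (v z.1 - v z.2) := by
        simp only [Pi.add_apply]; ring
      rw [this]
      have := abs_add_le (u z.1 - u z.2) (v z.1 - v z.2)
      have := le_max_left a b
      have := le_max_right a b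
      linarith
    calc |(u + v) z.1 - (u + v) z.2| ^ p ≤ (2 * max a b) ^ p :=
          Real.rpow_le_rpow (abs_nonneg _) h1 (by linarith)
      _ = 2 ^ p * max a b ^ p := Real.mul_rpow (by norm_num) (le_max_of_le_left ha)
      _ ≤ 2 ^ p * (a ^ p + b ^ p) := by
          gcongr
          have := Real.rpow_nonneg ha p
          have := Real.rpow_nonneg hb p
          rcases max_choice a b with h | h <;> rw [h] <;> linarith
  unfold energyDensity
  calc _ ≤ k ‖z.1 - z.2‖ * (2 ^ p * (|u z.1 - u z.2| ^ p + |v z.1 - v z.2| ^ p))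
          / ‖z.1 - z.2‖ ^ p := by gcongr
    _ = _ := by ring

/-- The constrained energy space `X₀`: the functions `u ∈ L^p(ℝ^N)` of finite energy that vanish
a.e. outside `Ω`. Its elements are functions, not classes; everything below depends only on the
a.e. class of a function. -/
def X₀ {N : ℕ} {p : ℝ} (hp : 1 < p) {k : ℝ → ℝ} (hk : IsKernel N p k) (Ω : Set (E N)) :
    Submodule ℝ (E N → ℝ) where
  carrier := {u | MemLp u (ENNReal.ofReal p) ∧ energy p k u < ∞ ∧ ∀ᵐ x, x ∉ Ω → u x = 0}
  zero_mem' := by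
    refine ⟨MemLp.zero, ?_, by simp⟩
    simp [energy, energyDensity, Real.zero_rpow (by linarith : p ≠ 0)]
  add_mem' := by
    rintro u v ⟨hu, hu', hu0⟩ ⟨hv, hv', hv0⟩
    refine ⟨hu.add hv, ?_, ?_⟩
    · have hm := (aemeasurable_energyDensity hk hu.1).ennreal_ofReal
      calc energy p k (u + v)
          ≤ ∫⁻ z : E N × E N, ENNReal.ofReal (2 ^ p) * (ENNReal.ofReal (energyDensity p k u z)
              + ENNReal.ofReal (energyDensity p k v z)) := by
            refine lintegral_mono fun z => ?_
            rw [← ENNReal.ofReal_add (energyDensity_nonneg hp hk _ _)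
              (energyDensity_nonneg hp hk _ _), ← ENNReal.ofReal_mul (by positivity)]
            exact ENNReal.ofReal_le_ofReal (energyDensity_add_le hp hk u v z)
        _ = ENNReal.ofReal (2 ^ p) * (energy p k u + energy p k v) := by
            rw [lintegral_const_mul' _ _ ENNReal.ofReal_ne_top, lintegral_add_left' hm]
            rfl
        _ < ∞ := ENNReal.mul_lt_top ENNReal.ofReal_lt_top (ENNReal.add_lt_top.2 ⟨hu', hv'⟩)
    · filter_upwards [hu0, hv0] with x h1 h2 hx
      simp [h1 hx, h2 hx]
  smul_mem' := by
    rintro c u ⟨hu, hu', hu0⟩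
    refine ⟨hu.const_smul c, ?_, ?_⟩
    · have : ∀ z : E N × E N, energyDensity p k (c • u) z
          = |c| ^ p * energyDensity p k u z := by
        intro z
        simp only [energyDensity, Pi.smul_apply, smul_eq_mul]
        rw [← mul_sub, abs_mul, Real.mul_rpow (abs_nonneg _) (abs_nonneg _)]
        ring
      simp only [energy, this, ENNReal.ofReal_mul (Real.rpow_nonneg (abs_nonneg c) p)]
      rw [lintegral_const_mul' _ _ ENNReal.ofReal_ne_top]
      exact ENNReal.mul_lt_top ENNReal.ofReal_lt_top hu'
    · filter_upwards [hu0] with x h1 hx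
      simp [h1 hx]

/-- The norm `‖u‖_{X₀} = B(u, u)^{1/p}`. -/
def normX₀ {N : ℕ} (p : ℝ) (k : ℝ → ℝ) (u : E N → ℝ) : ℝ :=
  (energy p k u).toReal ^ (1 / p)

/-- The linear functional `f` on `X₀` belongs to the dual space `X₀'`. -/
def IsDual {N : ℕ} {p : ℝ} {hp : 1 < p} {k : ℝ → ℝ} {hk : IsKernel N p k} {Ω : Set (E N)}
    (f : X₀ hp hk Ω →ₗ[ℝ] ℝ) : Prop :=
  ∃ C : ℝ, ∀ v : X₀ hp hk Ω, |f v| ≤ C * normX₀ p k (v : E N → ℝ)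

/-- Weak convergence in `X₀`. -/
def TendstoWeaklyX₀ {N : ℕ} {p : ℝ} {hp : 1 < p} {k : ℝ → ℝ} {hk : IsKernel N p k}
    {Ω : Set (E N)} (u : ℕ → X₀ hp hk Ω) (u₀ : X₀ hp hk Ω) : Prop :=
  ∀ φ : X₀ hp hk Ω →ₗ[ℝ] ℝ, IsDual φ → Tendsto (fun j => φ (u j)) atTop (𝓝 (φ u₀))

/-- Strong convergence in `X₀`. -/
def TendstoStronglyX₀ {N : ℕ} {p : ℝ} {hp : 1 < p} {k : ℝ → ℝ} {hk : IsKernel N p k}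
    {Ω : Set (E N)} (u : ℕ → X₀ hp hk Ω) (u₀ : X₀ hp hk Ω) : Prop :=
  Tendsto (fun j => normX₀ p k ((u j - u₀ : X₀ hp hk Ω) : E N → ℝ)) atTop (𝓝 0)

/-- The set `ℋ` of diffusion coefficients: the symmetric measurable functions on `ℝ^N × ℝ^N` with
values in `[hmin, hmax]` a.e. -/
def coefficients (N : ℕ) (hmin hmax : ℝ) : Set (E N × E N → ℝ) :=
  {h | AEStronglyMeasurable h ∧ (∀ᵐ z, h z.swap = h z) ∧ ∀ᵐ z, h z ∈ Icc hmin hmax}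

/-- Weak-* convergence in `L^∞(ℝ^N × ℝ^N)`, tested against `L^1`. -/
def TendstoWeakStar {N : ℕ} (h : ℕ → E N × E N → ℝ) (h₀ : E N × E N → ℝ) : Prop :=
  ∀ g : E N × E N → ℝ, Integrable g →
    Tendsto (fun j => ∫ z, h j z * g z) atTop (𝓝 (∫ z, h₀ z * g z))

/-- Weak convergence in `L^{p'}(ℝ^N × ℝ^N)`, `p' = p / (p - 1)`, tested against `L^p`. -/
def TendstoWeaklyLConj {N : ℕ} (p : ℝ) (F : ℕ → E N × E N → ℝ) (F₀ : E N × E N → ℝ) : Prop :=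
  (∀ j, MemLp (F j) (ENNReal.ofReal (p / (p - 1)))) ∧
  MemLp F₀ (ENNReal.ofReal (p / (p - 1))) ∧
  ∀ G : E N × E N → ℝ, MemLp G (ENNReal.ofReal p) →
    Tendsto (fun j => ∫ z, F j z * G z) atTop (𝓝 (∫ z, F₀ z * G z))

/-- The form `B_h(u, v)`. -/
def form {N : ℕ} (p : ℝ) (k : ℝ → ℝ) (h : E N × E N → ℝ) (u v : E N → ℝ) : ℝ :=
  ∫ z : E N × E N, h z * (k ‖z.1 - z.2‖ * |u z.1 - u z.2| ^ (p - 2) * (u z.1 - u z.2)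
    * (v z.1 - v z.2) / ‖z.1 - z.2‖ ^ p)

/-- `u = 𝓛_h⁻¹ f`: the function `u ∈ X₀` satisfies `B_h(u, v) = ⟨f, v⟩` for all `v ∈ X₀`. -/
def IsSolution {N : ℕ} {p : ℝ} {hp : 1 < p} {k : ℝ → ℝ} {hk : IsKernel N p k} {Ω : Set (E N)}
    (h : E N × E N → ℝ) (f : X₀ hp hk Ω →ₗ[ℝ] ℝ) (u : X₀ hp hk Ω) : Prop :=
  ∀ v : X₀ hp hk Ω, form p k h u v = f v

/-- The nonlocal flux of `u` for the coefficient `h`, at `z = (x', x)`; here `1 / p' = (p - 1) / p`. -/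
def flux {N : ℕ} (p : ℝ) (k : ℝ → ℝ) (h : E N × E N → ℝ) (u : E N → ℝ) (z : E N × E N) : ℝ :=
  h z * k ‖z.1 - z.2‖ ^ ((p - 1) / p) *
    (|u z.1 - u z.2| ^ (p - 2) * (u z.1 - u z.2) / ‖z.1 - z.2‖ ^ (p - 1))

/-- `(𝓛_{h_j})` `G`-converges (in the weak sense) to `𝓛_{h₀}`. -/
def GConverges {N : ℕ} {p : ℝ} (hp : 1 < p) {k : ℝ → ℝ} (hk : IsKernel N p k) (Ω : Set (E N))
    (h : ℕ → E N × E N → ℝ) (h₀ : E N × E N → ℝ) : Prop :=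
  ∀ f : X₀ hp hk Ω →ₗ[ℝ] ℝ, IsDual f →
    ∀ (u : ℕ → X₀ hp hk Ω) (u₀ : X₀ hp hk Ω),
      (∀ j, IsSolution (h j) f (u j)) → IsSolution h₀ f u₀ → TendstoWeaklyX₀ u u₀

/-- `(𝓛_{h_j})` `G`-converges in the strong sense to `𝓛_{h₀}`: the solutions converge strongly
in `X₀`, for every right-hand side. -/
def StrongGConverges {N : ℕ} {p : ℝ} (hp : 1 < p) {k : ℝ → ℝ} (hk : IsKernel N p k)
    (Ω : Set (E N)) (h : ℕ → E N × E N → ℝ) (h₀ : E N × E N → ℝ) : Prop :=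
  ∀ f : X₀ hp hk Ω →ₗ[ℝ] ℝ, IsDual f →
    ∀ (u : ℕ → X₀ hp hk Ω) (u₀ : X₀ hp hk Ω),
      (∀ j, IsSolution (h j) f (u j)) → IsSolution h₀ f u₀ → TendstoStronglyX₀ u u₀

/-- `(𝓛_{h_j})` `H`-converges to `𝓛_{h₀}`: for every right-hand side the solutions converge weakly
in `X₀` and their fluxes converge weakly in `L^{p'}`. -/
def HConverges {N : ℕ} {p : ℝ} (hp : 1 < p) {k : ℝ → ℝ} (hk : IsKernel N p k) (Ω : Set (E N))
    (h : ℕ → E N × E N → ℝ) (h₀ : E N × E N → ℝ) : Prop :=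
  ∀ f : X₀ hp hk Ω →ₗ[ℝ] ℝ, IsDual f →
    ∀ (u : ℕ → X₀ hp hk Ω) (u₀ : X₀ hp hk Ω),
      (∀ j, IsSolution (h j) f (u j)) → IsSolution h₀ f u₀ →
        TendstoWeaklyX₀ u u₀ ∧
          TendstoWeaklyLConj p (fun j => flux p k (h j) (u j)) (flux p k h₀ u₀)

end

end NonlocalPLaplacian

open NonlocalPLaplacian

/-! Write `g_v` for the weighted difference quotient `nonlocalGrad` of `v` and `σ` for the signed
power. Then the energy is `∫ |g_v|^p`, the form is `∫ h σ(g_u) g_v` and the flux is `h σ(g_u)`, so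
the problem looks like a local p-Laplacian with `g` in place of the gradient. One feature is special
to the nonlocal setting: compactness of `X₀` in `L^p` makes `g` of a weakly null sequence tend to
zero strongly in `L^p` away from the diagonal.

Weak convergence of solutions implies strong convergence. Put `w_j = u_j - u₀`. Monotonicity of `σ`
and `h_j ≥ hmin` bound `hmin ∫ (σ(g_{u_j}) - σ(g_{u₀})) g_{w_j}` by `f(w_j) - ∫ h_j σ(g_{u₀})
g_{w_j}`. The first term tends to zero by weak convergence. In the second the coefficient varies
with `j`, so weak convergence alone is not enough; but `∫ |σ(g_{u₀}) g_{w_j}|` tends to zero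
(`tendsto_integral_abs_pairing`): close to the diagonal the fixed function `g_{u₀}` carries little
mass, and elsewhere `g_{w_j}` tends to zero. Monotonicity in the quantitative form
`exists_abs_sub_rpow_le` then gives `∫ |g_{w_j}|^p → 0`; this is `tendstoStrongly_of_tendstoWeakly`.

Strong convergence and weak-* convergence of the coefficients imply convergence of the fluxes.
Against `G` in `L^p`, replacing `σ(g_{u_j})` by `σ(g_{u₀})` costs an error that vanishes uniformly
in the bounded coefficients, and `σ(g_{u₀}) G` is an integrable test function for `h_j`; this is
`tendstoWeakly_flux`.

Compactness (`tendsto_powIntegral_zero`) comes from comparing a function with its averages over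
small balls: the lower bound on `k` makes the oscillation at scale `δ` small relative to the energy,
and the averages of a weakly null sequence tend to zero pointwise. -/

namespace NonlocalPLaplacian

noncomputable section

/-! ### Homogeneous functions and inequalities for the signed power -/

/-- A continuous `p`-homogeneous function `F` is controlled, up to `ε ‖x‖ ^ p`, by a multiple of any
nonnegative continuous `p`-homogeneous function whose zeros are not positive values of `F`. -/
theorem exists_le_of_homogeneous {V : Type*} [NormedAddCommGroup V] [NormedSpace ℝ V]
    [ProperSpace V] {p : ℝ} (hp : 0 < p) {F H : V → ℝ} (hF : Continuous F) (hH : Continuous H)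
    (hFh : ∀ t : ℝ, 0 < t → ∀ x, F (t • x) = t ^ p * F x)
    (hHh : ∀ t : ℝ, 0 < t → ∀ x, H (t • x) = t ^ p * H x)
    (hH0 : ∀ x, 0 ≤ H x) (hz : ∀ x, H x = 0 → F x ≤ 0) {ε : ℝ} (hε : 0 < ε) :
    ∃ C : ℝ, 0 ≤ C ∧ ∀ x, F x ≤ ε * ‖x‖ ^ p + C * H x := by
  have hsph : ∃ C : ℝ, 0 ≤ C ∧ ∀ x ∈ Metric.sphere (0 : V) 1, F x ≤ ε + C * H x := by
    -- By homogeneity it is enough to argue on the unit sphere. Only the compact part where `F ≥ ε`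
    -- matters, and there `H` has a positive minimum, since a zero of `H` would force `F ≤ 0`. The
    -- constant is then `max F / min H` over that part.
    set K : Set V := Metric.sphere (0 : V) 1 ∩ {x | ε ≤ F x} with hK
    have hKc : IsCompact K :=
      (isCompact_sphere (0 : V) 1).inter_right (isClosed_le continuous_const hF)
    rcases K.eq_empty_or_nonempty with h | h
    · refine ⟨0, le_rfl, fun x hx => ?_⟩
      have : x ∉ K := by simp [h]
      simp only [hK, mem_inter_iff, hx, true_and, mem_ofPred_eq, not_le] at this
      linarith
    · obtain ⟨x₁, hx₁, hmin⟩ := hKc.exists_isMinOn h hH.continuousOn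
      obtain ⟨x₂, hx₂, hmax⟩ := hKc.exists_isMaxOn h hF.continuousOn
      have hpos : 0 < H x₁ := by
        refine lt_of_le_of_ne (hH0 _) fun h0 => ?_
        have := hz _ h0.symm
        have := hx₁.2
        simp only [mem_ofPred_eq] at this
        linarith
      have hM : 0 < F x₂ := lt_of_lt_of_le hε hx₂.2
      refine ⟨F x₂ / H x₁, by positivity, fun x hx => ?_⟩
      have hC : 0 ≤ F x₂ / H x₁ := by positivity
      by_cases hxe : ε ≤ F x
      · have h1 : H x₁ ≤ H x := hmin ⟨hx, hxe⟩
        have h2 : F x ≤ F x₂ := hmax ⟨hx, hxe⟩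
        have h3 : F x₂ / H x₁ * H x₁ ≤ F x₂ / H x₁ * H x := by gcongr
        rw [div_mul_cancel₀ _ hpos.ne'] at h3
        linarith
      · have := mul_nonneg hC (hH0 x)
        linarith
  obtain ⟨C, hC, hle⟩ := hsph
  refine ⟨C, hC, fun x => ?_⟩
  -- The origin cannot be rescaled to the sphere; homogeneity with `t = 2` gives `G 0 = 2 ^ p * G
  -- 0`, hence `G 0 = 0`.
  have hzero : ∀ G : V → ℝ, (∀ t : ℝ, 0 < t → ∀ x, G (t • x) = t ^ p * G x) → G 0 = 0 := by
    intro G hG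
    have h2 := hG 2 two_pos 0
    rw [smul_zero] at h2
    have : (1 : ℝ) < 2 ^ p := Real.one_lt_rpow one_lt_two hp
    by_contra hne
    have := mul_right_cancel₀ hne (h2.symm.trans (one_mul _).symm)
    linarith
  rcases eq_or_ne x 0 with rfl | hx
  · rw [hzero F hFh, hzero H hHh, norm_zero, Real.zero_rpow hp.ne']
    simp
  · have hn : 0 < ‖x‖ := norm_pos_iff.2 hx
    have h1 := hle (‖x‖⁻¹ • x) (by simp [norm_smul, hn.ne'])
    have hx' : x = ‖x‖ • (‖x‖⁻¹ • x) := by rw [smul_smul, mul_inv_cancel₀ hn.ne', one_smul]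
    have h2 : F x = ‖x‖ ^ p * F (‖x‖⁻¹ • x) := by conv_lhs => rw [hx', hFh _ hn]
    have h3 : H x = ‖x‖ ^ p * H (‖x‖⁻¹ • x) := by conv_lhs => rw [hx', hHh _ hn]
    rw [h2, h3]
    calc _ ≤ ‖x‖ ^ p * (ε + C * H (‖x‖⁻¹ • x)) := by gcongr
      _ = _ := by ring

/-- The signed power `a ↦ |a| ^ (p - 2) a`. -/
def signedPow (p a : ℝ) : ℝ := |a| ^ (p - 2) * a

theorem signedPow_of_nonneg {p : ℝ} (hp : 1 < p) {a : ℝ} (ha : 0 ≤ a) :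
    signedPow p a = a ^ (p - 1) := by
  unfold signedPow
  rcases ha.eq_or_lt with rfl | h
  · rw [mul_zero, Real.zero_rpow (by linarith)]
  · rw [abs_of_pos h, ← Real.rpow_add_one h.ne']; ring_nf

theorem signedPow_neg (p a : ℝ) : signedPow p (-a) = -signedPow p a := by
  simp [signedPow]

theorem abs_signedPow {p : ℝ} (hp : 1 < p) (a : ℝ) : |signedPow p a| = |a| ^ (p - 1) := by
  rw [← signedPow_of_nonneg hp (abs_nonneg a)]
  unfold signedPow
  rw [abs_mul, abs_abs, abs_of_nonneg (Real.rpow_nonneg (abs_nonneg a) _)]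

theorem signedPow_mul_self {p : ℝ} (hp : 1 < p) (a : ℝ) : signedPow p a * a = |a| ^ p := by
  have h : signedPow p a * a = |signedPow p a| * |a| := by
    rw [← abs_mul, abs_of_nonneg]
    unfold signedPow
    rw [mul_assoc]
    exact mul_nonneg (Real.rpow_nonneg (abs_nonneg a) _) (mul_self_nonneg a)
  rw [h, abs_signedPow hp]
  rcases (abs_nonneg a).eq_or_lt with h | h
  · rw [← h, mul_zero, Real.zero_rpow (by linarith)]
  · rw [← Real.rpow_add_one h.ne']; ring_nf

theorem signedPow_mul {p t : ℝ} (ht : 0 < t) (a : ℝ) :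
    signedPow p (t * a) = t ^ (p - 1) * signedPow p a := by
  unfold signedPow
  rw [abs_mul, abs_of_pos ht, Real.mul_rpow ht.le (abs_nonneg a)]
  have : t ^ (p - 1) = t ^ (p - 2) * t := by rw [← Real.rpow_add_one ht.ne']; ring_nf
  rw [this]; ring

theorem strictMono_signedPow {p : ℝ} (hp : 1 < p) : StrictMono (signedPow p) := by
  refine strictMono_of_odd_strictMonoOn_nonneg (signedPow_neg p) fun a ha b hb hab => ?_
  rw [signedPow_of_nonneg hp ha, signedPow_of_nonneg hp hb]
  exact Real.rpow_lt_rpow ha hab (by linarith)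

theorem continuous_signedPow {p : ℝ} (hp : 1 < p) : Continuous (signedPow p) := by
  rw [continuous_iff_continuousAt]
  intro a
  rcases eq_or_ne a 0 with rfl | ha
  · have h0 : signedPow p 0 = 0 := by simp [signedPow]
    rw [ContinuousAt, h0, tendsto_zero_iff_abs_tendsto_zero]
    have : Continuous fun a : ℝ => |a| ^ (p - 1) :=
      continuous_abs.rpow_const fun _ => Or.inr (by linarith)
    have h := this.tendsto 0
    rw [abs_zero, Real.zero_rpow (by linarith)] at h
    exact h.congr fun a => (abs_signedPow hp a).symm
  · exact (continuous_abs.continuousAt.rpow_const (Or.inl (abs_ne_zero.2 ha))).mul continuousAt_id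

theorem signedPow_monotone_pairing {p : ℝ} (hp : 1 < p) (a b : ℝ) :
    0 ≤ (signedPow p a - signedPow p b) * (a - b) ∧
      ((signedPow p a - signedPow p b) * (a - b) = 0 → a = b) := by
  rcases lt_trichotomy a b with h | rfl | h
  · have := strictMono_signedPow hp h
    have := mul_pos_of_neg_of_neg (sub_neg.2 this) (sub_neg.2 h)
    exact ⟨this.le, fun h => absurd h this.ne'⟩
  · simp
  · have := strictMono_signedPow hp h
    have := mul_pos (sub_pos.2 this) (sub_pos.2 h)
    exact ⟨this.le, fun h => absurd h this.ne'⟩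

theorem rpow_prod_norm_le (p : ℝ) (a b : ℝ) : ‖(a, b)‖ ^ p ≤ |a| ^ p + |b| ^ p := by
  have h1 := Real.rpow_nonneg (abs_nonneg a) p
  have h2 := Real.rpow_nonneg (abs_nonneg b) p
  rw [Prod.norm_mk, Real.norm_eq_abs, Real.norm_eq_abs]
  rcases max_choice |a| |b| with h | h <;> rw [h] <;> linarith

theorem abs_mul_rpow_of_pos {t : ℝ} (ht : 0 < t) (p a : ℝ) : |t * a| ^ p = t ^ p * |a| ^ p := by
  rw [abs_mul, abs_of_pos ht, Real.mul_rpow ht.le (abs_nonneg a)]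

theorem rpow_sub_one_mul_self {t : ℝ} (ht : 0 < t) (p : ℝ) : t ^ (p - 1) * t = t ^ p := by
  rw [← Real.rpow_add_one ht.ne']; ring_nf

theorem abs_mul_scale {t : ℝ} (ht : 0 < t) (p a b : ℝ) :
    |t ^ (p - 1) * a * (t * b)| = t ^ p * |a * b| := by
  have h : t ^ (p - 1) * a * (t * b) = t ^ p * (a * b) := by
    rw [← rpow_sub_one_mul_self ht p]; ring
  rw [h, abs_mul, abs_of_pos (Real.rpow_pos_of_pos ht p)]

/-- Young's inequality for the signed power, with the small constant on the second factor. -/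
theorem exists_signedPow_mul_le_left {p : ℝ} (hp : 1 < p) {ε : ℝ} (hε : 0 < ε) :
    ∃ C : ℝ, 0 ≤ C ∧ ∀ a d : ℝ, |signedPow p a * d| ≤ ε * (|a| ^ p + |d| ^ p) + C * |a| ^ p := by
  have hp0 : 0 < p := by linarith
  obtain ⟨C, hC, h⟩ := exists_le_of_homogeneous (V := ℝ × ℝ) hp0
    (F := fun x => |signedPow p x.1 * x.2|) (H := fun x => |x.1| ^ p)
    (((continuous_signedPow hp).comp continuous_fst).mul continuous_snd).abs
    (continuous_fst.abs.rpow_const fun _ => Or.inr hp0.le)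
    (fun t ht x => by
      simp only [Prod.smul_fst, Prod.smul_snd, smul_eq_mul, signedPow_mul ht]
      exact abs_mul_scale ht p _ _)
    (fun t ht x => abs_mul_rpow_of_pos ht p x.1)
    (fun x => Real.rpow_nonneg (abs_nonneg _) p)
    (fun x hx => by
      have : x.1 = 0 := by
        rwa [Real.rpow_eq_zero (abs_nonneg _) hp0.ne', abs_eq_zero] at hx
      simp [this, signedPow]) hε
  refine ⟨C, hC, fun a d => (h (a, d)).trans ?_⟩
  have := rpow_prod_norm_le p a d
  gcongr

/-- Young's inequality for the signed power, with the small constant on the first factor. -/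
theorem exists_signedPow_mul_le_right {p : ℝ} (hp : 1 < p) {ε : ℝ} (hε : 0 < ε) :
    ∃ C : ℝ, 0 ≤ C ∧ ∀ a d : ℝ, |signedPow p a * d| ≤ ε * (|a| ^ p + |d| ^ p) + C * |d| ^ p := by
  have hp0 : 0 < p := by linarith
  obtain ⟨C, hC, h⟩ := exists_le_of_homogeneous (V := ℝ × ℝ) hp0
    (F := fun x => |signedPow p x.1 * x.2|) (H := fun x => |x.2| ^ p)
    (((continuous_signedPow hp).comp continuous_fst).mul continuous_snd).abs
    (continuous_snd.abs.rpow_const fun _ => Or.inr hp0.le)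
    (fun t ht x => by
      simp only [Prod.smul_fst, Prod.smul_snd, smul_eq_mul, signedPow_mul ht]
      exact abs_mul_scale ht p _ _)
    (fun t ht x => abs_mul_rpow_of_pos ht p x.2)
    (fun x => Real.rpow_nonneg (abs_nonneg _) p)
    (fun x hx => by
      have : x.2 = 0 := by
        rwa [Real.rpow_eq_zero (abs_nonneg _) hp0.ne', abs_eq_zero] at hx
      simp [this]) hε
  refine ⟨C, hC, fun a d => (h (a, d)).trans ?_⟩
  have := rpow_prod_norm_le p a d
  gcongr

/-- Strong monotonicity of the signed power up to a small error. -/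
theorem exists_abs_sub_rpow_le {p : ℝ} (hp : 1 < p) {ε : ℝ} (hε : 0 < ε) :
    ∃ C : ℝ, 0 ≤ C ∧ ∀ a b : ℝ, |a - b| ^ p
      ≤ ε * (|a| ^ p + |b| ^ p) + C * ((signedPow p a - signedPow p b) * (a - b)) := by
  have hp0 : 0 < p := by linarith
  have hc := continuous_signedPow hp
  obtain ⟨C, hC, h⟩ := exists_le_of_homogeneous (V := ℝ × ℝ) hp0
    (F := fun x => |x.1 - x.2| ^ p)
    (H := fun x => (signedPow p x.1 - signedPow p x.2) * (x.1 - x.2))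
    ((continuous_fst.sub continuous_snd).abs.rpow_const fun _ => Or.inr hp0.le)
    (((hc.comp continuous_fst).sub (hc.comp continuous_snd)).mul
      (continuous_fst.sub continuous_snd))
    (fun t ht x => by
      simp only [Prod.smul_fst, Prod.smul_snd, smul_eq_mul, ← mul_sub]
      exact abs_mul_rpow_of_pos ht p _)
    (fun t ht x => by
      simp only [Prod.smul_fst, Prod.smul_snd, smul_eq_mul, signedPow_mul ht, ← mul_sub]
      rw [← rpow_sub_one_mul_self ht p]
      ring)
    (fun x => (signedPow_monotone_pairing hp _ _).1)
    (fun x hx => by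
      have : x.1 = x.2 := (signedPow_monotone_pairing hp _ _).2 hx
      simp [this, Real.zero_rpow hp0.ne']) hε
  refine ⟨C, hC, fun a b => (h (a, b)).trans ?_⟩
  have := rpow_prod_norm_le p a b
  gcongr

/-- Continuity of the signed power, tested against `g`, up to a small error. -/
theorem exists_signedPow_sub_mul_le {p : ℝ} (hp : 1 < p) {ε : ℝ} (hε : 0 < ε) :
    ∃ C : ℝ, 0 ≤ C ∧ ∀ a b g : ℝ, |(signedPow p a - signedPow p b) * g|
      ≤ ε * (|a| ^ p + (|b| ^ p + |g| ^ p)) + C * |a - b| ^ p := by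
  have hp0 : 0 < p := by linarith
  have hc := continuous_signedPow hp
  have hc1 : Continuous fun x : ℝ × ℝ × ℝ => x.1 := continuous_fst
  have hc2 : Continuous fun x : ℝ × ℝ × ℝ => x.2.1 := continuous_fst.comp continuous_snd
  have hc3 : Continuous fun x : ℝ × ℝ × ℝ => x.2.2 := continuous_snd.comp continuous_snd
  obtain ⟨C, hC, h⟩ := exists_le_of_homogeneous (V := ℝ × ℝ × ℝ) hp0
    (F := fun x => |(signedPow p x.1 - signedPow p x.2.1) * x.2.2|)
    (H := fun x => |x.1 - x.2.1| ^ p)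
    (((hc.comp hc1).sub (hc.comp hc2)).mul hc3).abs
    ((hc1.sub hc2).abs.rpow_const fun _ => Or.inr hp0.le)
    (fun t ht x => by
      simp only [Prod.smul_fst, Prod.smul_snd, smul_eq_mul, signedPow_mul ht, ← mul_sub]
      exact abs_mul_scale ht p _ _)
    (fun t ht x => by
      simp only [Prod.smul_fst, Prod.smul_snd, smul_eq_mul, ← mul_sub]
      exact abs_mul_rpow_of_pos ht p _)
    (fun x => Real.rpow_nonneg (abs_nonneg _) p)
    (fun x hx => by
      have : x.1 = x.2.1 := by
        rwa [Real.rpow_eq_zero (abs_nonneg _) hp0.ne', abs_eq_zero, sub_eq_zero] at hx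
      simp [this]) hε
  refine ⟨C, hC, fun a b g => (h (a, b, g)).trans ?_⟩
  have h3 : ‖(a, b, g)‖ ^ p ≤ |a| ^ p + (|b| ^ p + |g| ^ p) := by
    have h1 := rpow_prod_norm_le p a ‖(b, g)‖
    have h2 := rpow_prod_norm_le p b g
    rw [abs_of_nonneg (norm_nonneg _)] at h1
    have : ‖(a, b, g)‖ = ‖(a, ‖(b, g)‖)‖ := by
      rw [Prod.norm_mk a ‖(b, g)‖, norm_norm]
      exact Prod.norm_mk _ _
    rw [this]
    linarith
  gcongr

theorem abs_signedPow_mul_le {p : ℝ} (hp : 1 < p) (a d : ℝ) :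
    |signedPow p a * d| ≤ |a| ^ p + |d| ^ p := by
  have ha := Real.rpow_nonneg (abs_nonneg a) p
  have hd := Real.rpow_nonneg (abs_nonneg d) p
  rw [abs_mul, abs_signedPow hp]
  have key : ∀ m : ℝ, 0 ≤ m → m ^ (p - 1) * m = m ^ p := by
    intro m hm
    rcases hm.eq_or_lt with rfl | h
    · rw [mul_zero, Real.zero_rpow (by linarith)]
    · exact rpow_sub_one_mul_self h p
  rcases le_total |a| |d| with h | h
  · calc |a| ^ (p - 1) * |d| ≤ |d| ^ (p - 1) * |d| := by gcongr
      _ ≤ _ := by rw [key _ (abs_nonneg d)]; linarith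
  · calc |a| ^ (p - 1) * |d| ≤ |a| ^ (p - 1) * |a| := by gcongr
      _ ≤ _ := by rw [key _ (abs_nonneg a)]; linarith

/-! ### Poincaré inequality and compactness of `X₀` in `L^p` -/

/-- The substitution `x' = z + x` makes the kernel depend on `z` alone, so that its tail and its
lower bound can be used for each fixed `x`. -/
theorem energy_eq_lintegral_lintegral {N : ℕ} {p : ℝ} {k : ℝ → ℝ} (hk : IsKernel N p k)
    {u : E N → ℝ} (hu : AEStronglyMeasurable u) :
    energy p k u = ∫⁻ x : E N, ∫⁻ z : E N,
      ENNReal.ofReal (k ‖z‖ * |u (z + x) - u x| ^ p / ‖z‖ ^ p) := by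
  unfold energy
  rw [Measure.volume_eq_prod,
    lintegral_prod_symm _ (aemeasurable_energyDensity hk hu).ennreal_ofReal]
  refine lintegral_congr fun x => ?_
  rw [← lintegral_add_right_eq_self _ x]
  simp [energyDensity]

/-- The integral of `|u|^p`. -/
def powIntegral {N : ℕ} (p : ℝ) (u : E N → ℝ) : ℝ≥0∞ := ∫⁻ x, ENNReal.ofReal (|u x| ^ p)

/-- The tail `∫_{|z| ≥ ε} k(|z|) / |z|^p` of the kernel. -/
def kernelTail (N : ℕ) (p : ℝ) (k : ℝ → ℝ) (ε : ℝ) : ℝ≥0∞ :=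
  ∫⁻ z in (Metric.ball (0 : E N) ε)ᶜ, ENNReal.ofReal (k ‖z‖ / ‖z‖ ^ p)

theorem kernelTail_lt_top {N : ℕ} {p : ℝ} {k : ℝ → ℝ} (hk : IsKernel N p k) {ε : ℝ}
    (hε : 0 < ε) : kernelTail N p k ε < ∞ :=
  (hk.tail ε hε).lintegral_lt_top

/-- A zero tail and `k > 0` would make the complement of a ball null, giving a ball infinite volume.
The assumption `0 < N` enters here: in dimension zero that complement is empty. -/
theorem kernelTail_pos {N : ℕ} (hN : 0 < N) {p : ℝ} {k : ℝ → ℝ} (hk : IsKernel N p k) {ε : ℝ}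
    (hε : 0 < ε) : 0 < kernelTail N p k ε := by
  have : Nonempty (Fin N) := ⟨⟨0, hN⟩⟩
  have hms : MeasurableSet ((Metric.ball (0 : E N) ε)ᶜ) := Metric.isOpen_ball.measurableSet.compl
  have hm : AEMeasurable (fun z : E N => ENNReal.ofReal (k ‖z‖ / ‖z‖ ^ p))
      (volume.restrict (Metric.ball (0 : E N) ε)ᶜ) :=
    (hk.tail ε hε).aestronglyMeasurable.aemeasurable.ennreal_ofReal
  refine pos_iff_ne_zero.2 fun h0 => ?_
  rw [kernelTail, lintegral_eq_zero_iff' hm, EventuallyEq, ae_restrict_iff' hms] at h0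
  have hnull : volume ((Metric.ball (0 : E N) ε)ᶜ) = 0 := by
    refine measure_mono_null (fun z hz => ?_) (ae_iff.1 h0)
    simp only [mem_ofPred_eq, Classical.not_imp]
    refine ⟨hz, ?_⟩
    have hz' : 0 < ‖z‖ := by
      have : ε ≤ ‖z‖ := by simpa using hz
      linarith
    have := hk.pos _ hz'
    have : 0 < k ‖z‖ / ‖z‖ ^ p := by positivity
    simpa using this
  have h1 : volume (Metric.ball (0 : E N) ε) < ∞ := measure_ball_lt_top
  have h2 := measure_add_measure_compl (μ := (volume : Measure (E N)))
    (Metric.isOpen_ball (x := (0 : E N)) (ε := ε)).measurableSet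
  rw [hnull, add_zero, measure_univ_of_isAddLeftInvariant] at h2
  exact h1.ne h2

theorem ae_translate {N : ℕ} {P : E N → Prop} (h : ∀ᵐ x, P x) (y : E N) : ∀ᵐ x, P (x + y) :=
  (measurePreserving_add_right volume y).quasiMeasurePreserving.ae h

/-- A Poincaré inequality: for functions supported in a bounded set the energy controls the
`L^p` norm. -/
theorem exists_powIntegral_le {N : ℕ} (hN : 0 < N) {p : ℝ} (hp : 1 < p) {k : ℝ → ℝ}
    (hk : IsKernel N p k) {Ω : Set (E N)} (hΩb : Bornology.IsBounded Ω) :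
    ∃ C : ℝ≥0∞, C ≠ ∞ ∧ ∀ v : X₀ hp hk Ω,
      powIntegral p (v : E N → ℝ) ≤ C * energy p k (v : E N → ℝ) := by
  obtain ⟨R, hR, hΩR⟩ := hΩb.subset_ball_lt 0 (0 : E N)
  set τ := kernelTail N p k (2 * R) with hτ
  have hτ0 : τ ≠ 0 := (kernelTail_pos hN hk (by positivity)).ne'
  have hτt : τ ≠ ∞ := (kernelTail_lt_top hk (by positivity)).ne
  refine ⟨τ⁻¹, ENNReal.inv_ne_top.2 hτ0, fun v => ?_⟩
  obtain ⟨hvL, -, hv0⟩ := v.2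
  have key : τ * powIntegral p (v : E N → ℝ) ≤ energy p k (v : E N → ℝ) := by
    rw [energy_eq_lintegral_lintegral hk hvL.1, powIntegral, ← lintegral_const_mul' _ _ hτt]
    refine lintegral_mono_ae ?_
    filter_upwards [hv0] with x hx
    by_cases hxΩ : x ∈ Ω
    swap
    · simp [hx hxΩ, Real.zero_rpow (by linarith : p ≠ 0)]
    -- For `x` in `Ω` and `|z| ≥ 2R` the point `z + x` lies outside `Ω`, so the difference reduces
    -- to `-v(x)` and these `z` alone contribute `τ |v(x)|^p`.
    refine le_trans ?_ (setLIntegral_le_lintegral (Metric.ball (0 : E N) (2 * R))ᶜ _)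
    rw [hτ, kernelTail, ← lintegral_mul_const' _ _ ENNReal.ofReal_ne_top]
    refine setLIntegral_mono_ae' Metric.isOpen_ball.measurableSet.compl ?_
    filter_upwards [ae_translate hv0 x] with z hz hzR
    have hzR' : 2 * R ≤ ‖z‖ := by simpa using hzR
    have hxR : ‖x‖ < R := by simpa using hΩR hxΩ
    have hzx : z + x ∉ Ω := by
      intro hmem
      have h1 : ‖z + x‖ < R := by simpa using hΩR hmem
      have h2 : ‖z‖ ≤ ‖z + x‖ + ‖x‖ := by simpa using norm_sub_le (z + x) x
      linarith
    rw [hz hzx, zero_sub, abs_neg, ← ENNReal.ofReal_mul' (Real.rpow_nonneg (abs_nonneg _) _)]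
    exact ENNReal.ofReal_le_ofReal (le_of_eq (by ring))
  calc powIntegral p (v : E N → ℝ) = τ⁻¹ * (τ * powIntegral p (v : E N → ℝ)) := by
        rw [← mul_assoc, ENNReal.inv_mul_cancel hτ0 hτt, one_mul]
    _ ≤ _ := by gcongr

/-- Hölder's inequality against the constant function `1`. -/
theorem lintegral_rpow_le {α : Type*} [MeasurableSpace α] (μ : Measure α) {p : ℝ} (hp : 1 < p)
    {g : α → ℝ≥0∞} (hg : AEMeasurable g μ) :
    (∫⁻ a, g a ∂μ) ^ p ≤ μ univ ^ (p - 1) * ∫⁻ a, g a ^ p ∂μ := by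
  have hpq := Real.HolderConjugate.conjExponent hp
  have h := ENNReal.lintegral_mul_le_Lp_mul_Lq μ hpq hg
    (aemeasurable_const (b := (1 : ℝ≥0∞)))
  simp only [Pi.mul_apply, mul_one, ENNReal.one_rpow, lintegral_const, one_mul] at h
  calc (∫⁻ a, g a ∂μ) ^ p
      ≤ ((∫⁻ a, g a ^ p ∂μ) ^ (1 / p) * μ univ ^ (1 / p.conjExponent)) ^ p := by gcongr
    _ = _ := by
      rw [ENNReal.mul_rpow_of_nonneg _ _ (by linarith), ← ENNReal.rpow_mul, ← ENNReal.rpow_mul,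
        one_div_mul_cancel (by linarith), ENNReal.rpow_one, mul_comm]
      congr 2
      have := hpq.symm.inv_add_inv_eq_one
      have h1 : (p.conjExponent)⁻¹ = 1 - p⁻¹ := by linarith
      rw [one_div, h1]
      field_simp

/-- The integral of `u` over the ball of radius `δ` around `x`. -/
def ballIntegral {N : ℕ} (δ : ℝ) (u : E N → ℝ) (x : E N) : ℝ :=
  ∫ z in Metric.ball (0 : E N) δ, u (z + x)

theorem memLp_translate {N : ℕ} {q : ℝ≥0∞} {u : E N → ℝ} (hu : MemLp u q) (x : E N) :
    MemLp (fun z => u (z + x)) q :=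
  hu.comp_measurePreserving (measurePreserving_add_right volume x)

theorem integrableOn_ball_translate {N : ℕ} {p : ℝ} (hp : 1 < p) {u : E N → ℝ}
    (hu : MemLp u (ENNReal.ofReal p)) (δ : ℝ) (x : E N) :
    IntegrableOn (fun z => u (z + x)) (Metric.ball (0 : E N) δ) := by
  have : IsFiniteMeasure (volume.restrict (Metric.ball (0 : E N) δ)) :=
    ⟨by simpa using measure_ball_lt_top⟩
  exact ((memLp_translate hu x).restrict _).integrable (by simpa using hp.le)

theorem aestronglyMeasurable_ballIntegral {N : ℕ} {u : E N → ℝ} (hu : AEStronglyMeasurable u)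
    (δ : ℝ) : AEStronglyMeasurable (ballIntegral δ u) := by
  have h : AEStronglyMeasurable (fun z : E N × E N => u (z.2 + z.1)) := by
    have h1 := quasiMeasurePreserving_add (volume : Measure (E N)) (volume : Measure (E N))
    have := hu.comp_quasiMeasurePreserving h1
    refine this.congr (Eventually.of_forall fun z => ?_)
    simp [add_comm]
  have hac : (volume : Measure (E N)).prod (volume.restrict (Metric.ball (0 : E N) δ))
      ≪ (volume : Measure (E N)).prod volume :=
    Measure.AbsolutelyContinuous.rfl.prod Measure.restrict_le_self.absolutelyContinuous
  exact (h.mono_ac hac).integral_prod_right'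

theorem ofReal_abs_rpow {p : ℝ} (hp : 0 ≤ p) (a : ℝ) :
    ENNReal.ofReal (|a| ^ p) = ENNReal.ofReal |a| ^ p :=
  (ENNReal.ofReal_rpow_of_nonneg (abs_nonneg a) hp).symm

theorem ofReal_abs_setIntegral_rpow_le {N : ℕ} {p : ℝ} (hp : 1 < p) {g : E N → ℝ} {δ : ℝ}
    (hg : IntegrableOn g (Metric.ball (0 : E N) δ)) :
    ENNReal.ofReal (|∫ z in Metric.ball (0 : E N) δ, g z| ^ p)
      ≤ volume (Metric.ball (0 : E N) δ) ^ (p - 1)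
        * ∫⁻ z in Metric.ball (0 : E N) δ, ENNReal.ofReal (|g z| ^ p) := by
  have h1 : ENNReal.ofReal |∫ z in Metric.ball (0 : E N) δ, g z|
      ≤ ∫⁻ z in Metric.ball (0 : E N) δ, ENNReal.ofReal |g z| := by
    rw [← ofReal_integral_eq_lintegral_ofReal hg.abs (Eventually.of_forall fun _ => abs_nonneg _)]
    exact ENNReal.ofReal_le_ofReal (abs_integral_le_integral_abs)
  have h2 := lintegral_rpow_le (volume.restrict (Metric.ball (0 : E N) δ)) hp
    hg.abs.aestronglyMeasurable.aemeasurable.ennreal_ofReal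
  rw [Measure.restrict_apply_univ] at h2
  simp only [ofReal_abs_rpow (by linarith : 0 ≤ p)]
  calc _ ≤ (∫⁻ z in Metric.ball (0 : E N) δ, ENNReal.ofReal |g z|) ^ p := by gcongr
    _ ≤ _ := h2

theorem ofReal_abs_ballIntegral_rpow_le {N : ℕ} {p : ℝ} (hp : 1 < p) {u : E N → ℝ}
    (hu : MemLp u (ENNReal.ofReal p)) (δ : ℝ) (x : E N) :
    ENNReal.ofReal (|ballIntegral δ u x| ^ p)
      ≤ volume (Metric.ball (0 : E N) δ) ^ (p - 1) * powIntegral p u := by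
  refine (ofReal_abs_setIntegral_rpow_le hp (integrableOn_ball_translate hp hu δ x)).trans ?_
  gcongr
  refine (setLIntegral_le_lintegral _ _).trans (le_of_eq ?_)
  exact lintegral_add_right_eq_self (fun y => ENNReal.ofReal (|u y| ^ p)) x

/-- A function is controlled by its oscillation and its averages over balls. -/
theorem volume_ball_rpow_mul_le {N : ℕ} {p : ℝ} (hp : 1 < p) {u : E N → ℝ}
    (hu : MemLp u (ENNReal.ofReal p)) (δ : ℝ) (x : E N) :
    volume (Metric.ball (0 : E N) δ) ^ p * ENNReal.ofReal (|u x| ^ p)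
      ≤ 2 ^ (p - 1) * (volume (Metric.ball (0 : E N) δ) ^ (p - 1)
          * (∫⁻ z in Metric.ball (0 : E N) δ, ENNReal.ofReal (|u (z + x) - u x| ^ p))
        + ENNReal.ofReal (|ballIntegral δ u x| ^ p)) := by
  have hp0 : 0 ≤ p := by linarith
  set b := volume (Metric.ball (0 : E N) δ) with hb
  have hbt : b ≠ ∞ := measure_ball_lt_top.ne
  have hi := integrableOn_ball_translate hp hu δ x
  have hc : IntegrableOn (fun _ : E N => u x) (Metric.ball (0 : E N) δ) :=
    integrableOn_const hbt
  have hsub : IntegrableOn (fun z => u (z + x) - u x) (Metric.ball (0 : E N) δ) := hi.sub hc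
  have h1 : b.toReal * u x
      = ballIntegral δ u x - ∫ z in Metric.ball (0 : E N) δ, (u (z + x) - u x) := by
    rw [integral_sub hi hc, ballIntegral, setIntegral_const, smul_eq_mul, Measure.real]
    ring
  have h2 : b.toReal * |u x| ≤ |∫ z in Metric.ball (0 : E N) δ, (u (z + x) - u x)|
      + |ballIntegral δ u x| := by
    rw [← abs_of_nonneg (ENNReal.toReal_nonneg (a := b)), ← abs_mul, h1, add_comm]
    exact abs_sub _ _
  have h3 : b * ENNReal.ofReal |u x|
      ≤ ENNReal.ofReal |∫ z in Metric.ball (0 : E N) δ, (u (z + x) - u x)|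
        + ENNReal.ofReal |ballIntegral δ u x| := by
    rw [← ENNReal.ofReal_add (abs_nonneg _) (abs_nonneg _)]
    conv_lhs => rw [← ENNReal.ofReal_toReal hbt]
    rw [← ENNReal.ofReal_mul ENNReal.toReal_nonneg]
    exact ENNReal.ofReal_le_ofReal h2
  calc b ^ p * ENNReal.ofReal (|u x| ^ p) = (b * ENNReal.ofReal |u x|) ^ p := by
        rw [ofReal_abs_rpow hp0, ENNReal.mul_rpow_of_nonneg _ _ hp0]
    _ ≤ (ENNReal.ofReal |∫ z in Metric.ball (0 : E N) δ, (u (z + x) - u x)|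
        + ENNReal.ofReal |ballIntegral δ u x|) ^ p := by gcongr
    _ ≤ 2 ^ (p - 1) * (ENNReal.ofReal |∫ z in Metric.ball (0 : E N) δ, (u (z + x) - u x)| ^ p
        + ENNReal.ofReal |ballIntegral δ u x| ^ p) :=
        ENNReal.rpow_add_le_mul_rpow_add_rpow _ _ hp.le
    _ ≤ _ := by
        rw [← ofReal_abs_rpow hp0, ← ofReal_abs_rpow hp0]
        gcongr
        exact ofReal_abs_setIntegral_rpow_le hp hsub

/-- On the ball, `k(|z|) / |z|^p ≥ c₀ / |z|^(N + s p) ≥ c₀ / δ^(N + s p)`, so the unweighted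
oscillation is a small multiple of the energy. -/
theorem lintegral_ball_osc_le {N : ℕ} {p : ℝ} (hp : 1 < p) {k : ℝ → ℝ} (hk : IsKernel N p k)
    {c₀ s r₀ δ : ℝ} (hc₀ : 0 < c₀) (hs : 0 < s)
    (hlow : ∀ z : E N, z ≠ 0 → ‖z‖ < r₀ → c₀ / ‖z‖ ^ ((N : ℝ) + (s - 1) * p) ≤ k ‖z‖)
    (hδ : 0 < δ) (hδr : δ ≤ r₀) {u : E N → ℝ} (hu : AEStronglyMeasurable u) :
    ∫⁻ x : E N, ∫⁻ z in Metric.ball (0 : E N) δ, ENNReal.ofReal (|u (z + x) - u x| ^ p)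
      ≤ ENNReal.ofReal (δ ^ (N + s * p) / c₀) * energy p k u := by
  rw [energy_eq_lintegral_lintegral hk hu, ← lintegral_const_mul' _ _ ENNReal.ofReal_ne_top]
  refine lintegral_mono fun x => ?_
  rw [← lintegral_const_mul' _ _ ENNReal.ofReal_ne_top]
  refine le_trans ?_ (setLIntegral_le_lintegral (Metric.ball (0 : E N) δ) _)
  refine setLIntegral_mono' Metric.isOpen_ball.measurableSet fun z hz => ?_
  rw [← ENNReal.ofReal_mul (by positivity)]
  refine ENNReal.ofReal_le_ofReal ?_
  have hzδ : ‖z‖ < δ := by simpa using hz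
  rcases eq_or_ne z 0 with rfl | hz0
  · simp [Real.zero_rpow (by linarith : p ≠ 0)]
  have hn : 0 < ‖z‖ := norm_pos_iff.2 hz0
  have h1 := hlow z hz0 (hzδ.trans_le hδr)
  have h2 : 1 ≤ δ ^ (N + s * p) / c₀ * (k ‖z‖ / ‖z‖ ^ p) := by
    have hexp : ‖z‖ ^ ((N : ℝ) + (s - 1) * p) * ‖z‖ ^ p = ‖z‖ ^ (N + s * p) := by
      rw [← Real.rpow_add hn]; ring_nf
    have h3 : ‖z‖ ^ (N + s * p) ≤ δ ^ (N + s * p) :=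
      Real.rpow_le_rpow hn.le hzδ.le (by positivity)
    have h4 : 0 < ‖z‖ ^ (N + s * p) := by positivity
    calc (1 : ℝ) ≤ δ ^ (N + s * p) / ‖z‖ ^ (N + s * p) := (one_le_div h4).2 h3
      _ = δ ^ (N + s * p) / c₀ * (c₀ / ‖z‖ ^ ((N : ℝ) + (s - 1) * p) / ‖z‖ ^ p) := by
          rw [← hexp]; field_simp
      _ ≤ _ := by gcongr
  calc |u (z + x) - u x| ^ p = 1 * |u (z + x) - u x| ^ p := (one_mul _).symm
    _ ≤ δ ^ (N + s * p) / c₀ * (k ‖z‖ / ‖z‖ ^ p) * |u (z + x) - u x| ^ p := by gcongr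
    _ = _ := by ring

/-- The oscillation bound gives a factor `δ^(N + s p)`, and normalising by the ball volume `β δ^N`
leaves `δ^(s p)`, which is small because `s > 0`. What remains is an average over a ball, which weak
convergence can handle. -/
theorem exists_powIntegral_le_ballIntegral {N : ℕ} {p : ℝ} (hp : 1 < p) {k : ℝ → ℝ}
    (hk : IsKernel N p k) {Ω : Set (E N)} (hΩ : MeasurableSet Ω) {η : ℝ}
    (hη : 0 < η) : ∃ δ : ℝ, ∃ C : ℝ≥0∞, C ≠ ∞ ∧ ∀ v : X₀ hp hk Ω, powIntegral p (v : E N → ℝ)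
      ≤ ENNReal.ofReal η * energy p k (v : E N → ℝ)
        + C * ∫⁻ x in Ω, ENNReal.ofReal (|ballIntegral δ (v : E N → ℝ) x| ^ p) := by
  obtain ⟨c₀, s, r₀, hc₀, hs, -, hr₀, hlow⟩ := hk.lower
  set β := (volume (Metric.ball (0 : E N) 1)).toReal with hβ
  have hβ0 : 0 < β :=
    ENNReal.toReal_pos (Metric.measure_ball_pos volume _ one_pos).ne' measure_ball_lt_top.ne
  -- This is exactly the factor of the energy in the final estimate; `δ` is chosen to make it less
  -- than `η`, subject to `0 < δ < r₀`.
  have hlim : Tendsto (fun δ : ℝ => 2 ^ (p - 1) * (δ ^ (s * p) / (c₀ * β))) (𝓝[>] 0) (𝓝 0) := by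
    have h1 : Continuous fun δ : ℝ => 2 ^ (p - 1) * (δ ^ (s * p) / (c₀ * β)) :=
      continuous_const.mul ((continuous_id.rpow_const fun _ =>
        Or.inr (by positivity)).div_const _)
    have h2 := h1.tendsto 0
    rw [Real.zero_rpow (by positivity), zero_div, mul_zero] at h2
    exact h2.mono_left nhdsWithin_le_nhds
  obtain ⟨δ, hδη, hδr, hδ⟩ := ((hlim.eventually_lt_const hη).and
    ((eventually_nhdsWithin_of_eventually_nhds (eventually_lt_nhds hr₀)).and
      (eventually_mem_nhdsWithin (a := (0 : ℝ)) (s := Ioi 0)))).exists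
  replace hδ : 0 < δ := hδ
  set m := δ ^ N * β with hm
  have hm0 : 0 < m := by positivity
  have hb : volume (Metric.ball (0 : E N) δ) = ENNReal.ofReal m := by
    rw [Measure.addHaar_ball_of_pos _ _ hδ, hm, ENNReal.ofReal_mul (by positivity), hβ,
      ENNReal.ofReal_toReal measure_ball_lt_top.ne, finrank_euclideanSpace, Fintype.card_fin]
  refine ⟨δ, ENNReal.ofReal (2 ^ (p - 1) / m ^ p), ENNReal.ofReal_ne_top, fun v => ?_⟩
  obtain ⟨hvL, -, hv0⟩ := v.2
  set w : E N → ℝ := (v : E N → ℝ) with hw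
  set A : E N → ℝ≥0∞ := fun x => ENNReal.ofReal (|ballIntegral δ w x| ^ p) with hA
  set O : E N → ℝ≥0∞ := fun x => ∫⁻ z in Metric.ball (0 : E N) δ,
    ENNReal.ofReal (|w (z + x) - w x| ^ p) with hO
  have hAm : AEMeasurable A := by
    have := (aestronglyMeasurable_ballIntegral hvL.1 δ).aemeasurable
    exact ((continuous_abs.measurable.comp_aemeasurable this).pow_const p).ennreal_ofReal
  have hpt : ∀ᵐ x, ENNReal.ofReal (|w x| ^ p)
      ≤ ENNReal.ofReal (2 ^ (p - 1) / m) * O x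
        + Ω.indicator (fun x => ENNReal.ofReal (2 ^ (p - 1) / m ^ p) * A x) x := by
    filter_upwards [hv0] with x hx
    by_cases hxΩ : x ∈ Ω
    swap
    · simp [hx hxΩ, Real.zero_rpow (by linarith : p ≠ 0)]
    have h := volume_ball_rpow_mul_le hp hvL δ x
    rw [hb] at h
    have hmp : ENNReal.ofReal m ^ p = ENNReal.ofReal (m ^ p) := ENNReal.ofReal_rpow_of_pos hm0
    have hmp1 : ENNReal.ofReal m ^ (p - 1) = ENNReal.ofReal (m ^ (p - 1)) :=
      ENNReal.ofReal_rpow_of_pos hm0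
    have h2p : (2 : ℝ≥0∞) ^ (p - 1) = ENNReal.ofReal (2 ^ (p - 1)) := by
      rw [← ENNReal.ofReal_rpow_of_pos two_pos, ENNReal.ofReal_ofNat]
    rw [hmp, hmp1, h2p] at h
    have hmpos : 0 < m ^ p := by positivity
    calc ENNReal.ofReal (|w x| ^ p)
        = ENNReal.ofReal (m ^ p)⁻¹ * (ENNReal.ofReal (m ^ p) * ENNReal.ofReal (|w x| ^ p)) := by
          rw [← mul_assoc, ← ENNReal.ofReal_mul (by positivity), inv_mul_cancel₀ hmpos.ne',
            ENNReal.ofReal_one, one_mul]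
      _ ≤ ENNReal.ofReal (m ^ p)⁻¹ * (ENNReal.ofReal (2 ^ (p - 1))
            * (ENNReal.ofReal (m ^ (p - 1)) * O x + A x)) := by gcongr
      _ = ENNReal.ofReal ((m ^ p)⁻¹ * (2 ^ (p - 1) * m ^ (p - 1))) * O x
            + ENNReal.ofReal ((m ^ p)⁻¹ * 2 ^ (p - 1)) * A x := by
          rw [ENNReal.ofReal_mul (by positivity), ENNReal.ofReal_mul (by positivity),
            ENNReal.ofReal_mul (by positivity)]
          ring
      _ = _ := by
          have : (m ^ p)⁻¹ * (2 ^ (p - 1) * m ^ (p - 1)) = 2 ^ (p - 1) / m := by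
            rw [← rpow_sub_one_mul_self hm0 p]
            field_simp
          rw [this, indicator_of_mem hxΩ, inv_mul_eq_div]
  calc powIntegral p w
      ≤ ∫⁻ x, (ENNReal.ofReal (2 ^ (p - 1) / m) * O x
        + Ω.indicator (fun x => ENNReal.ofReal (2 ^ (p - 1) / m ^ p) * A x) x) :=
        lintegral_mono_ae hpt
    _ ≤ (∫⁻ x, ENNReal.ofReal (2 ^ (p - 1) / m) * O x)
        + ∫⁻ x in Ω, ENNReal.ofReal (2 ^ (p - 1) / m ^ p) * A x := by
        rw [lintegral_add_right' _ ((hAm.const_mul _).indicator hΩ), lintegral_indicator hΩ]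
    _ ≤ _ := by
        rw [lintegral_const_mul' _ _ ENNReal.ofReal_ne_top,
          lintegral_const_mul' _ _ ENNReal.ofReal_ne_top]
        refine add_le_add_left ?_ _
        calc ENNReal.ofReal (2 ^ (p - 1) / m) * ∫⁻ x, O x
            ≤ ENNReal.ofReal (2 ^ (p - 1) / m)
              * (ENNReal.ofReal (δ ^ (N + s * p) / c₀) * energy p k w) := by
              gcongr
              exact lintegral_ball_osc_le hp hk hc₀ hs hlow hδ hδr.le hvL.1
          _ = ENNReal.ofReal (2 ^ (p - 1) * (δ ^ (s * p) / (c₀ * β))) * energy p k w := by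
              rw [← mul_assoc, ← ENNReal.ofReal_mul (by positivity)]
              congr 2
              rw [Real.rpow_add hδ, Real.rpow_natCast, hm]
              field_simp
          _ ≤ _ := by gcongr

theorem toReal_energy_eq {N : ℕ} {p : ℝ} (hp : 1 < p) {k : ℝ → ℝ} (u : E N → ℝ) :
    (energy p k u).toReal = normX₀ p k u ^ p := by
  rw [normX₀, ← Real.rpow_mul ENNReal.toReal_nonneg, one_div_mul_cancel (by linarith),
    Real.rpow_one]

theorem normX₀_nonneg {N : ℕ} (p : ℝ) (k : ℝ → ℝ) (u : E N → ℝ) : 0 ≤ normX₀ p k u :=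
  Real.rpow_nonneg ENNReal.toReal_nonneg _

theorem isDual_of_rpow_le {N : ℕ} {p : ℝ} {hp : 1 < p} {k : ℝ → ℝ} {hk : IsKernel N p k}
    {Ω : Set (E N)} (f : X₀ hp hk Ω →ₗ[ℝ] ℝ) {C : ℝ≥0∞} (hC : C ≠ ∞)
    (h : ∀ v : X₀ hp hk Ω, ENNReal.ofReal (|f v| ^ p) ≤ C * energy p k (v : E N → ℝ)) :
    IsDual f := by
  have hp0 : 0 < p := by linarith
  refine ⟨C.toReal ^ (1 / p), fun v => ?_⟩
  have hfin : energy p k (v : E N → ℝ) ≠ ∞ := v.2.2.1.ne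
  have h1 : |f v| ^ p ≤ C.toReal * (energy p k (v : E N → ℝ)).toReal := by
    rw [← ENNReal.toReal_mul]
    exact (ENNReal.ofReal_le_iff_le_toReal (ENNReal.mul_ne_top hC hfin)).1 (h v)
  calc |f v| = (|f v| ^ p) ^ (1 / p) := by
        rw [← Real.rpow_mul (abs_nonneg _), mul_one_div_cancel hp0.ne', Real.rpow_one]
    _ ≤ (C.toReal * (energy p k (v : E N → ℝ)).toReal) ^ (1 / p) := by gcongr
    _ = _ := by
        rw [Real.mul_rpow ENNReal.toReal_nonneg ENNReal.toReal_nonneg, normX₀]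

/-- The integral over a ball, as a linear functional on `X₀`. -/
def ballFunctional {N : ℕ} {p : ℝ} (hp : 1 < p) {k : ℝ → ℝ} (hk : IsKernel N p k)
    (Ω : Set (E N)) (δ : ℝ) (x : E N) : X₀ hp hk Ω →ₗ[ℝ] ℝ where
  toFun v := ballIntegral δ (v : E N → ℝ) x
  map_add' u v := integral_add (integrableOn_ball_translate hp u.2.1 δ x)
    (integrableOn_ball_translate hp v.2.1 δ x)
  map_smul' c _ := integral_const_mul c _

/-- Hölder bounds the ball integral by the `L^p` norm, and the Poincaré inequality bounds that by
the energy. Weak convergence in `X₀` therefore gives pointwise convergence of ball integrals. -/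
theorem isDual_ballFunctional {N : ℕ} (hN : 0 < N) {p : ℝ} (hp : 1 < p) {k : ℝ → ℝ}
    (hk : IsKernel N p k) {Ω : Set (E N)} (hΩb : Bornology.IsBounded Ω) (δ : ℝ) (x : E N) :
    IsDual (ballFunctional hp hk Ω δ x) := by
  obtain ⟨C, hC, h⟩ := exists_powIntegral_le hN hp hk hΩb
  have hbt : volume (Metric.ball (0 : E N) δ) ^ (p - 1) ≠ ∞ :=
    ENNReal.rpow_ne_top_of_nonneg (by linarith) measure_ball_lt_top.ne
  refine isDual_of_rpow_le _ (ENNReal.mul_ne_top hbt hC) fun v => ?_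
  refine (ofReal_abs_ballIntegral_rpow_le hp v.2.1 δ x).trans ?_
  rw [mul_assoc]
  gcongr
  exact h v

/-- The compact embedding of `X₀` into `L^p`, in sequential form. -/
theorem tendsto_powIntegral_zero {N : ℕ} (hN : 0 < N) {p : ℝ} (hp : 1 < p) {k : ℝ → ℝ}
    (hk : IsKernel N p k) {Ω : Set (E N)} (hΩ : MeasurableSet Ω) (hΩb : Bornology.IsBounded Ω)
    {w : ℕ → X₀ hp hk Ω} (hw : TendstoWeaklyX₀ w 0) {M : ℝ≥0∞} (hM : M ≠ ∞)
    (hwM : ∀ j, energy p k (w j : E N → ℝ) ≤ M) :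
    Tendsto (fun j => powIntegral p (w j : E N → ℝ)) atTop (𝓝 0) := by
  have hp0 : 0 < p := by linarith
  rw [ENNReal.tendsto_nhds_zero]
  intro ε hε
  obtain ⟨η, hη, hηε⟩ : ∃ η : ℝ, 0 < η ∧ ENNReal.ofReal η * M ≤ ε / 2 := by
    rcases eq_or_ne ε ∞ with rfl | hεt
    · exact ⟨1, one_pos, by simp [ENNReal.top_div]⟩
    have hε' : 0 < ε.toReal := ENNReal.toReal_pos hε.ne' hεt
    have hM' : 0 ≤ M.toReal := ENNReal.toReal_nonneg
    -- The `+ 1` keeps the witness positive when `M = 0`.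
    refine ⟨ε.toReal / 2 / (M.toReal + 1), by positivity, ?_⟩
    rw [← ENNReal.ofReal_toReal hM, ← ENNReal.ofReal_mul (by positivity)]
    rw [← ENNReal.ofReal_toReal hεt, ← ENNReal.ofReal_ofNat 2, ← ENNReal.ofReal_div_of_pos two_pos,
      ENNReal.toReal_ofReal hε'.le, ENNReal.toReal_ofReal hM']
    refine ENNReal.ofReal_le_ofReal ?_
    rw [div_mul_eq_mul_div, div_le_iff₀ (by positivity)]
    gcongr
    linarith
  obtain ⟨δ, C, hC, hle⟩ := exists_powIntegral_le_ballIntegral hp hk hΩ hη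
  obtain ⟨K, hK, hpoin⟩ := exists_powIntegral_le hN hp hk hΩb
  have hbt : volume (Metric.ball (0 : E N) δ) ^ (p - 1) ≠ ∞ :=
    ENNReal.rpow_ne_top_of_nonneg (by linarith) measure_ball_lt_top.ne
  -- Dominated convergence: the ball integrals tend to zero pointwise and are bounded uniformly in
  -- `x` and `j`, and `Ω` has finite measure.
  have hlim : Tendsto (fun j => ∫⁻ x in Ω,
      ENNReal.ofReal (|ballIntegral δ (w j : E N → ℝ) x| ^ p)) atTop (𝓝 0) := by
    rw [← lintegral_zero (μ := volume.restrict Ω)]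
    refine tendsto_lintegral_of_dominated_convergence'
      (fun _ => volume (Metric.ball (0 : E N) δ) ^ (p - 1) * (K * M)) (fun j => ?_)
      (fun j => Eventually.of_forall fun x => ?_) ?_ (Eventually.of_forall fun x => ?_)
    · have := (aestronglyMeasurable_ballIntegral (w j).2.1.1 δ).aemeasurable
      exact ((continuous_abs.measurable.comp_aemeasurable
        this).pow_const p).ennreal_ofReal.restrict
    · refine (ofReal_abs_ballIntegral_rpow_le hp (w j).2.1 δ x).trans ?_
      exact mul_le_mul_right ((hpoin (w j)).trans (mul_le_mul_right (hwM j) _)) _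
    · rw [lintegral_const, Measure.restrict_apply_univ]
      exact ENNReal.mul_ne_top (ENNReal.mul_ne_top hbt (ENNReal.mul_ne_top hK hM))
        hΩb.measure_lt_top.ne
    · have h1 := hw _ (isDual_ballFunctional hN hp hk hΩb δ x)
      rw [map_zero] at h1
      have h2 : Continuous fun a : ℝ => ENNReal.ofReal (|a| ^ p) :=
        ENNReal.continuous_ofReal.comp (continuous_abs.rpow_const fun _ => Or.inr hp0.le)
      have h3 := (h2.tendsto 0).comp h1
      rw [abs_zero, Real.zero_rpow hp0.ne', ENNReal.ofReal_zero] at h3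
      exact h3
  have hlim2 := ENNReal.Tendsto.const_mul (a := C) hlim (Or.inr hC)
  rw [mul_zero, ENNReal.tendsto_nhds_zero] at hlim2
  filter_upwards [hlim2 (ε / 2) (ENNReal.half_pos hε.ne')] with j hj
  calc _ ≤ _ := hle (w j)
    _ ≤ ENNReal.ofReal η * M + ε / 2 := by
        gcongr
        exact hwM j
    _ ≤ ε / 2 + ε / 2 := by gcongr
    _ = ε := ENNReal.add_halves ε

/-- Away from the diagonal the energy is controlled by the `L^p` norm. -/
theorem lintegral_offDiagonal_energyDensity_le {N : ℕ} {p : ℝ} (hp : 1 < p) {k : ℝ → ℝ}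
    (hk : IsKernel N p k) {u : E N → ℝ} (hu : AEStronglyMeasurable u) (ε : ℝ) :
    ∫⁻ z in {z : E N × E N | ε ≤ ‖z.1 - z.2‖}, ENNReal.ofReal (energyDensity p k u z)
      ≤ 2 ^ p * (kernelTail N p k ε * powIntegral p u) := by
  have hp0 : 0 < p := by linarith
  set G : E N → ℝ≥0∞ := (Metric.ball (0 : E N) ε)ᶜ.indicator
    fun z => ENNReal.ofReal (k ‖z‖ / ‖z‖ ^ p) with hG
  set a : E N → ℝ≥0∞ := fun x => ENNReal.ofReal (|u x| ^ p) with ha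
  have hms : MeasurableSet ((Metric.ball (0 : E N) ε)ᶜ) := Metric.isOpen_ball.measurableSet.compl
  have hGm : AEMeasurable G := by
    refine AEMeasurable.indicator ?_ hms
    exact (hk.locallyIntegrable.aestronglyMeasurable.aemeasurable.div
      (measurable_norm.pow_const p).aemeasurable).ennreal_ofReal
  have ham : AEMeasurable a :=
    ((continuous_abs.measurable.comp_aemeasurable hu.aemeasurable).pow_const p).ennreal_ofReal
  have hGint : ∫⁻ z, G z = kernelTail N p k ε := lintegral_indicator hms _
  have hGp : AEMeasurable (fun z : E N × E N => G (z.1 - z.2)) :=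
    hGm.comp_quasiMeasurePreserving
      (quasiMeasurePreserving_sub (volume : Measure (E N)) volume)
  have h1m : AEMeasurable (fun z : E N × E N => a z.1) :=
    ham.comp_quasiMeasurePreserving Measure.quasiMeasurePreserving_fst
  have h2m : AEMeasurable (fun z : E N × E N => a z.2) :=
    ham.comp_quasiMeasurePreserving Measure.quasiMeasurePreserving_snd
  have h1G : AEMeasurable (fun z : E N × E N => G (z.1 - z.2) * a z.1) := hGp.mul h1m
  have h2G : AEMeasurable (fun z : E N × E N => G (z.1 - z.2) * a z.2) := hGp.mul h2m
  have hS : MeasurableSet {z : E N × E N | ε ≤ ‖z.1 - z.2‖} :=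
    (isClosed_le continuous_const (continuous_fst.sub continuous_snd).norm).measurableSet
  -- Splitting `|u(x') - u(x)|^p` separates the variables; each of the two terms then integrates to
  -- the kernel tail times `∫ |u|^p` by translation invariance.
  have hpt : ∀ z ∈ {z : E N × E N | ε ≤ ‖z.1 - z.2‖}, ENNReal.ofReal (energyDensity p k u z)
      ≤ 2 ^ (p - 1) * (G (z.1 - z.2) * a z.1 + G (z.1 - z.2) * a z.2) := by
    intro z hz
    have hz' : z.1 - z.2 ∈ (Metric.ball (0 : E N) ε)ᶜ := by simpa using hz
    have habs : ENNReal.ofReal (|u z.1 - u z.2| ^ p) ≤ 2 ^ (p - 1) * (a z.1 + a z.2) := by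
      simp only [ha, ofReal_abs_rpow hp0.le]
      refine le_trans ?_ (ENNReal.rpow_add_le_mul_rpow_add_rpow _ _ hp.le)
      refine ENNReal.rpow_le_rpow ?_ hp0.le
      rw [← ENNReal.ofReal_add (abs_nonneg _) (abs_nonneg _)]
      exact ENNReal.ofReal_le_ofReal (abs_sub _ _)
    calc ENNReal.ofReal (energyDensity p k u z)
        = G (z.1 - z.2) * ENNReal.ofReal (|u z.1 - u z.2| ^ p) := by
          rw [hG, indicator_of_mem hz', energyDensity,
            ← ENNReal.ofReal_mul' (Real.rpow_nonneg (abs_nonneg _) _)]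
          congr 1
          ring
      _ ≤ G (z.1 - z.2) * (2 ^ (p - 1) * (a z.1 + a z.2)) := by gcongr
      _ = _ := by ring
  have hI1 : ∫⁻ z : E N × E N, G (z.1 - z.2) * a z.1
      = kernelTail N p k ε * powIntegral p u := by
    rw [Measure.volume_eq_prod, lintegral_prod _ h1G, powIntegral,
      ← lintegral_const_mul'' _ ham]
    refine lintegral_congr fun x => ?_
    dsimp only
    rw [lintegral_mul_const' (a x) _ ENNReal.ofReal_ne_top, lintegral_sub_left_eq_self G x, hGint]
  have hI2 : ∫⁻ z : E N × E N, G (z.1 - z.2) * a z.2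
      = kernelTail N p k ε * powIntegral p u := by
    rw [Measure.volume_eq_prod, lintegral_prod_symm _ h2G, powIntegral,
      ← lintegral_const_mul'' _ ham]
    refine lintegral_congr fun x => ?_
    dsimp only
    rw [lintegral_mul_const' (a x) _ ENNReal.ofReal_ne_top, lintegral_sub_right_eq_self G x, hGint]
  calc _ ≤ ∫⁻ z in {z : E N × E N | ε ≤ ‖z.1 - z.2‖},
          2 ^ (p - 1) * (G (z.1 - z.2) * a z.1 + G (z.1 - z.2) * a z.2) :=
        setLIntegral_mono' hS hpt
    _ ≤ ∫⁻ z : E N × E N, 2 ^ (p - 1) * (G (z.1 - z.2) * a z.1 + G (z.1 - z.2) * a z.2) :=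
        setLIntegral_le_lintegral _ _
    _ = 2 ^ (p - 1) * (kernelTail N p k ε * powIntegral p u
          + kernelTail N p k ε * powIntegral p u) := by
        rw [lintegral_const_mul' _ _ (ENNReal.rpow_ne_top_of_nonneg (by linarith) (by simp)),
          lintegral_add_left' h1G, hI1, hI2]
    _ = 2 ^ p * (kernelTail N p k ε * powIntegral p u) := by
        rw [← two_mul, ← mul_assoc]
        congr 1
        conv_lhs => rw [← ENNReal.rpow_one 2, ← ENNReal.rpow_mul, one_mul]
        rw [← ENNReal.rpow_add _ _ two_ne_zero (by simp)]
        congr 1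
        ring

/-! ### Energy, form and flux in terms of the nonlocal gradient -/

/-- The weighted difference quotient `k(|x' - x|)^{1/p} (u(x') - u(x)) / |x' - x|`. -/
def nonlocalGrad {N : ℕ} (p : ℝ) (k : ℝ → ℝ) (u : E N → ℝ) (z : E N × E N) : ℝ :=
  k ‖z.1 - z.2‖ ^ (1 / p) / ‖z.1 - z.2‖ * (u z.1 - u z.2)

theorem nonlocalGrad_sub {N : ℕ} (p : ℝ) (k : ℝ → ℝ) (u v : E N → ℝ) (z : E N × E N) :
    nonlocalGrad p k (u - v) z = nonlocalGrad p k u z - nonlocalGrad p k v z := by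
  simp only [nonlocalGrad, Pi.sub_apply]; ring

theorem nonlocalGrad_of_norm_eq_zero {N : ℕ} (p : ℝ) (k : ℝ → ℝ) (u : E N → ℝ) {z : E N × E N}
    (hz : ‖z.1 - z.2‖ = 0) : nonlocalGrad p k u z = 0 := by
  simp [nonlocalGrad, hz]

theorem weight_pos {p : ℝ} {k : ℝ → ℝ} (hk : ∀ r : ℝ, 0 < r → 0 < k r) {r : ℝ} (hr : 0 < r) :
    0 < k r ^ (1 / p) / r :=
  div_pos (Real.rpow_pos_of_pos (hk r hr) _) hr

theorem weight_rpow {p : ℝ} {k : ℝ → ℝ} (hk : ∀ r : ℝ, 0 < r → 0 < k r) {r : ℝ}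
    (hr : 0 < r) (q : ℝ) : (k r ^ (1 / p) / r) ^ q = k r ^ (q / p) / r ^ q := by
  have := hk r hr
  rw [Real.div_rpow (by positivity) hr.le, ← Real.rpow_mul this.le, one_div_mul_eq_div]

theorem abs_nonlocalGrad_rpow {N : ℕ} {p : ℝ} (hp : 1 < p) {k : ℝ → ℝ} (hk : IsKernel N p k)
    (u : E N → ℝ) (z : E N × E N) : |nonlocalGrad p k u z| ^ p = energyDensity p k u z := by
  have hp0 : p ≠ 0 := by linarith
  rcases (norm_nonneg (z.1 - z.2)).eq_or_lt with h | h
  · rw [nonlocalGrad_of_norm_eq_zero p k u h.symm, energyDensity, ← h]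
    simp [Real.zero_rpow hp0]
  · rw [nonlocalGrad, abs_mul_rpow_of_pos (weight_pos hk.pos h), weight_rpow hk.pos h,
      div_self hp0, Real.rpow_one, energyDensity]
    ring

theorem signedPow_nonlocalGrad {N : ℕ} {p : ℝ} {k : ℝ → ℝ} (hk : IsKernel N p k)
    (u : E N → ℝ) {z : E N × E N} (h : 0 < ‖z.1 - z.2‖) :
    signedPow p (nonlocalGrad p k u z)
      = (k ‖z.1 - z.2‖ ^ (1 / p) / ‖z.1 - z.2‖) ^ (p - 1) * signedPow p (u z.1 - u z.2) :=
  signedPow_mul (weight_pos hk.pos h) _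

theorem flux_eq {N : ℕ} {p : ℝ} (hp : 1 < p) {k : ℝ → ℝ} (hk : IsKernel N p k)
    (h : E N × E N → ℝ) (u : E N → ℝ) (z : E N × E N) :
    flux p k h u z = h z * signedPow p (nonlocalGrad p k u z) := by
  have hp1 : p - 1 ≠ 0 := by linarith
  rcases (norm_nonneg (z.1 - z.2)).eq_or_lt with hz | hz
  · rw [nonlocalGrad_of_norm_eq_zero p k u hz.symm, flux, ← hz]
    simp [Real.zero_rpow hp1, signedPow]
  · rw [signedPow_nonlocalGrad hk u hz, weight_rpow hk.pos hz, flux, signedPow]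
    ring

/-- The kernel weight splits as its power `p - 1`, absorbed by the signed power, times one further
factor for the gradient of `v`. On the diagonal both integrands vanish, division by zero being zero.
-/
theorem form_eq {N : ℕ} {p : ℝ} (hp : 1 < p) {k : ℝ → ℝ} (hk : IsKernel N p k)
    (h : E N × E N → ℝ) (u v : E N → ℝ) :
    form p k h u v
      = ∫ z, h z * (signedPow p (nonlocalGrad p k u z) * nonlocalGrad p k v z) := by
  have hp0 : p ≠ 0 := by linarith
  refine integral_congr_ae (Eventually.of_forall fun z => ?_)
  simp only
  rcases (norm_nonneg (z.1 - z.2)).eq_or_lt with hz | hz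
  · rw [nonlocalGrad_of_norm_eq_zero p k v hz.symm, ← hz]
    simp [Real.zero_rpow hp0]
  · have h1 : (k ‖z.1 - z.2‖ ^ (1 / p) / ‖z.1 - z.2‖) ^ (p - 1)
        * (k ‖z.1 - z.2‖ ^ (1 / p) / ‖z.1 - z.2‖) = k ‖z.1 - z.2‖ / ‖z.1 - z.2‖ ^ p := by
      rw [rpow_sub_one_mul_self (weight_pos hk.pos hz), weight_rpow hk.pos hz, div_self hp0,
        Real.rpow_one]
    rw [signedPow_nonlocalGrad hk u hz]
    conv_rhs => rw [nonlocalGrad]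
    calc _ = h z * (k ‖z.1 - z.2‖ / ‖z.1 - z.2‖ ^ p
          * (signedPow p (u z.1 - u z.2) * (v z.1 - v z.2))) := by rw [signedPow]; ring
      _ = _ := by rw [← h1]; ring

theorem aestronglyMeasurable_nonlocalGrad {N : ℕ} {p : ℝ} {k : ℝ → ℝ} (hk : IsKernel N p k)
    {u : E N → ℝ} (hu : AEStronglyMeasurable u) :
    AEStronglyMeasurable (nonlocalGrad p k u) := by
  have h1 : AEMeasurable (fun z : E N × E N => u z.1) :=
    (hu.comp_quasiMeasurePreserving Measure.quasiMeasurePreserving_fst).aemeasurable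
  have h2 : AEMeasurable (fun z : E N × E N => u z.2) :=
    (hu.comp_quasiMeasurePreserving Measure.quasiMeasurePreserving_snd).aemeasurable
  have h3 : AEMeasurable (fun z : E N × E N => k ‖z.1 - z.2‖) :=
    (hk.locallyIntegrable.aestronglyMeasurable.comp_quasiMeasurePreserving
      (quasiMeasurePreserving_sub (volume : Measure (E N)) volume)).aemeasurable
  have h4 : AEMeasurable (fun z : E N × E N => ‖z.1 - z.2‖) :=
    (continuous_fst.sub continuous_snd).norm.measurable.aemeasurable
  exact (((h3.pow_const (1 / p)).div h4).mul (h1.sub h2)).aestronglyMeasurable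

/-! ### Integrability of pairings and limit arguments -/

section PowIntegrable

variable {α : Type*} [MeasurableSpace α] {μ : Measure α} {p : ℝ}

theorem integrable_signedPow_mul (hp : 1 < p) {a g : α → ℝ} (ha : AEStronglyMeasurable a μ)
    (hg : AEStronglyMeasurable g μ) (hai : Integrable (fun z => |a z| ^ p) μ)
    (hgi : Integrable (fun z => |g z| ^ p) μ) :
    Integrable (fun z => signedPow p (a z) * g z) μ := by
  refine (hai.add hgi).mono' (((continuous_signedPow hp).comp_aestronglyMeasurable ha).mul hg)
    (Eventually.of_forall fun z => ?_)
  exact abs_signedPow_mul_le hp (a z) (g z)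

theorem integrable_coefficient_mul {hmin hmax : ℝ} (hmin_pos : 0 < hmin) {h F : α → ℝ}
    (hh : AEStronglyMeasurable h μ) (hb : ∀ᵐ z ∂μ, h z ∈ Icc hmin hmax) (hF : Integrable F μ) :
    Integrable (fun z => h z * F z) μ := by
  refine hF.bdd_mul (c := hmax) hh ?_
  filter_upwards [hb] with z hz
  rw [Real.norm_eq_abs, abs_of_nonneg (hmin_pos.le.trans hz.1)]
  exact hz.2

theorem abs_integral_coefficient_mul_le {hmin hmax : ℝ} (hmin_pos : 0 < hmin) {h F : α → ℝ}
    (hb : ∀ᵐ z ∂μ, h z ∈ Icc hmin hmax) (hF : Integrable F μ) :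
    |∫ z, h z * F z ∂μ| ≤ hmax * ∫ z, |F z| ∂μ := by
  rw [← integral_const_mul]
  rw [← Real.norm_eq_abs]
  refine norm_integral_le_of_norm_le (hF.abs.const_mul hmax) ?_
  filter_upwards [hb] with z hz
  rw [Real.norm_eq_abs, abs_mul, abs_of_nonneg (hmin_pos.le.trans hz.1)]
  exact mul_le_mul_of_nonneg_right hz.2 (abs_nonneg _)

theorem memLp_signedPow (hp : 1 < p) {a : α → ℝ} (ha : AEStronglyMeasurable a μ)
    (hai : Integrable (fun z => |a z| ^ p) μ) :
    MemLp (fun z => signedPow p (a z)) (ENNReal.ofReal (p / (p - 1))) μ := by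
  have hp1 : 0 < p - 1 := by linarith
  have hq : 0 < p / (p - 1) := div_pos (by linarith) hp1
  rw [← integrable_norm_rpow_iff ((continuous_signedPow hp).comp_aestronglyMeasurable ha)
    (by simpa using hq) ENNReal.ofReal_ne_top, ENNReal.toReal_ofReal hq.le]
  refine hai.congr (Eventually.of_forall fun z => ?_)
  simp only [Real.norm_eq_abs]
  rw [abs_signedPow hp, ← Real.rpow_mul (abs_nonneg _), mul_div_cancel₀ _ hp1.ne']

end PowIntegrable

theorem integrable_abs_nonlocalGrad_rpow {N : ℕ} {p : ℝ} (hp : 1 < p) {k : ℝ → ℝ}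
    (hk : IsKernel N p k) {u : E N → ℝ} (hu : AEStronglyMeasurable u)
    (hfin : energy p k u < ∞) : Integrable (fun z => |nonlocalGrad p k u z| ^ p) := by
  simp only [abs_nonlocalGrad_rpow hp hk]
  refine (lintegral_ofReal_ne_top_iff_integrable
    (aemeasurable_energyDensity hk hu).aestronglyMeasurable
    (Eventually.of_forall (energyDensity_nonneg hp hk u))).1 hfin.ne

theorem setIntegral_abs_nonlocalGrad_rpow {N : ℕ} {p : ℝ} (hp : 1 < p) {k : ℝ → ℝ}
    (hk : IsKernel N p k) {u : E N → ℝ} (hu : AEStronglyMeasurable u) (S : Set (E N × E N)) :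
    ∫ z in S, |nonlocalGrad p k u z| ^ p
      = (∫⁻ z in S, ENNReal.ofReal (energyDensity p k u z)).toReal := by
  simp only [abs_nonlocalGrad_rpow hp hk]
  exact integral_eq_lintegral_of_nonneg_ae
    (Eventually.of_forall (energyDensity_nonneg hp hk u))
    (aemeasurable_energyDensity hk hu).aestronglyMeasurable.restrict

theorem integral_abs_nonlocalGrad_rpow {N : ℕ} {p : ℝ} (hp : 1 < p) {k : ℝ → ℝ}
    (hk : IsKernel N p k) {u : E N → ℝ} (hu : AEStronglyMeasurable u) :
    ∫ z, |nonlocalGrad p k u z| ^ p = (energy p k u).toReal := by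
  have := setIntegral_abs_nonlocalGrad_rpow hp hk hu univ
  rwa [setIntegral_univ, setLIntegral_univ] at this

theorem tendsto_zero_of_forall_le {e : ℕ → ℝ} (he : ∀ j, 0 ≤ e j)
    (h : ∀ η : ℝ, 0 < η → ∃ r : ℕ → ℝ, Tendsto r atTop (𝓝 0) ∧ ∀ j, e j ≤ η + r j) :
    Tendsto e atTop (𝓝 0) := by
  rw [Metric.tendsto_atTop']
  intro ε hε
  obtain ⟨r, hr, hle⟩ := h (ε / 2) (half_pos hε)
  obtain ⟨n, hn⟩ := eventually_atTop.1 (hr.eventually_lt_const (half_pos hε))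
  refine ⟨n, fun j hj => ?_⟩
  rw [Real.dist_eq, sub_zero, abs_of_nonneg (he j)]
  linarith [hle j, hn j hj.le]

/-- Variant of `tendsto_zero_of_forall_le` for inequalities with a constant depending on `η`. -/
theorem tendsto_zero_of_forall_exists_const {e r : ℕ → ℝ} (he : ∀ j, 0 ≤ e j) {M : ℝ}
    (hM : 0 ≤ M) (hr : Tendsto r atTop (𝓝 0))
    (h : ∀ η : ℝ, 0 < η → ∃ C : ℝ, ∀ j, e j ≤ η * M + C * r j) :
    Tendsto e atTop (𝓝 0) := by
  refine tendsto_zero_of_forall_le he fun η hη => ?_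
  obtain ⟨C, hC⟩ := h (η / (M + 1)) (by positivity)
  refine ⟨fun j => C * r j, by simpa using hr.const_mul C, fun j => (hC j).trans ?_⟩
  have : η / (M + 1) * M ≤ η := by
    rw [div_mul_eq_mul_div, div_le_iff₀ (by positivity)]
    nlinarith
  linarith

/-- Integrates a pointwise inequality with a small error. The error term is enlarged to the whole
space, where a uniform bound is available, while the main term stays on `S`, where it is small. -/
theorem setIntegral_le_of_forall_le {α : Type*} [MeasurableSpace α] {μ : Measure α}
    {F X Y : α → ℝ} {η C : ℝ} (hη : 0 ≤ η) (hF : Integrable F μ) (hX : Integrable X μ)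
    (hY : Integrable Y μ) (hX0 : ∀ z, 0 ≤ X z) (h : ∀ z, F z ≤ η * X z + C * Y z) (S : Set α) :
    ∫ z in S, F z ∂μ ≤ η * ∫ z, X z ∂μ + C * ∫ z in S, Y z ∂μ := by
  have hXS := hX.integrableOn (s := S)
  have hYS := hY.integrableOn (s := S)
  calc ∫ z in S, F z ∂μ ≤ ∫ z in S, (η * X z + C * Y z) ∂μ :=
        integral_mono hF.integrableOn ((hXS.const_mul η).add (hYS.const_mul C)) h
    _ = η * ∫ z in S, X z ∂μ + C * ∫ z in S, Y z ∂μ := by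
        rw [integral_add (hXS.const_mul η) (hYS.const_mul C), integral_const_mul,
          integral_const_mul]
    _ ≤ _ := by
        have := setIntegral_le_integral (s := S) hX (Eventually.of_forall hX0)
        gcongr

theorem energy_sub_le {N : ℕ} {p : ℝ} (hp : 1 < p) {k : ℝ → ℝ} (hk : IsKernel N p k)
    {u : E N → ℝ} (hu : AEStronglyMeasurable u) (v : E N → ℝ) :
    energy p k (u - v) ≤ ENNReal.ofReal (2 ^ p) * (energy p k u + energy p k v) := by
  have hm := (aemeasurable_energyDensity hk hu).ennreal_ofReal
  have hneg : ∀ z, energyDensity p k (-v) z = energyDensity p k v z := fun z => by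
    simp only [energyDensity, Pi.neg_apply]
    rw [← abs_neg]
    ring_nf
  calc energy p k (u - v)
      ≤ ∫⁻ z : E N × E N, ENNReal.ofReal (2 ^ p) * (ENNReal.ofReal (energyDensity p k u z)
          + ENNReal.ofReal (energyDensity p k v z)) := by
        refine lintegral_mono fun z => ?_
        rw [← ENNReal.ofReal_add (energyDensity_nonneg hp hk _ _)
          (energyDensity_nonneg hp hk _ _), ← ENNReal.ofReal_mul (by positivity), ← hneg z,
          sub_eq_add_neg]
        exact ENNReal.ofReal_le_ofReal (energyDensity_add_le hp hk u (-v) z)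
    _ = _ := by
        rw [lintegral_const_mul' _ _ ENNReal.ofReal_ne_top, lintegral_add_left' hm]
        rfl

/-! ### A priori bounds and weakly null sequences in `X₀` -/

section Space

variable {N : ℕ} {p : ℝ} {hp : 1 < p} {k : ℝ → ℝ} {hk : IsKernel N p k} {Ω : Set (E N)}

theorem aestronglyMeasurable_grad (u : X₀ hp hk Ω) :
    AEStronglyMeasurable (nonlocalGrad p k (u : E N → ℝ)) :=
  aestronglyMeasurable_nonlocalGrad hk u.2.1.1

theorem integrable_grad_rpow (u : X₀ hp hk Ω) :
    Integrable (fun z => |nonlocalGrad p k (u : E N → ℝ) z| ^ p) :=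
  integrable_abs_nonlocalGrad_rpow hp hk u.2.1.1 u.2.2.1

theorem integral_grad_rpow (u : X₀ hp hk Ω) :
    ∫ z, |nonlocalGrad p k (u : E N → ℝ) z| ^ p = (energy p k (u : E N → ℝ)).toReal :=
  integral_abs_nonlocalGrad_rpow hp hk u.2.1.1

theorem integrable_pairing (u v : X₀ hp hk Ω) :
    Integrable (fun z => signedPow p (nonlocalGrad p k (u : E N → ℝ) z)
      * nonlocalGrad p k (v : E N → ℝ) z) :=
  integrable_signedPow_mul hp (aestronglyMeasurable_grad u) (aestronglyMeasurable_grad v)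
    (integrable_grad_rpow u) (integrable_grad_rpow v)

theorem integral_grad_rpow_le (u : X₀ hp hk Ω) {M : ℝ≥0∞} (hM : M ≠ ∞)
    (h : energy p k (u : E N → ℝ) ≤ M) :
    ∫ z, |nonlocalGrad p k (u : E N → ℝ) z| ^ p ≤ M.toReal := by
  rw [(integral_grad_rpow u)]
  exact ENNReal.toReal_mono hM h

/-- Solutions have energies bounded uniformly in the coefficient. -/
theorem exists_energy_le_of_isSolution {hmin hmax : ℝ} (hmin_pos : 0 < hmin)
    {f : X₀ hp hk Ω →ₗ[ℝ] ℝ} (hf : IsDual f) :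
    ∃ M : ℝ≥0∞, M ≠ ∞ ∧ ∀ h ∈ coefficients N hmin hmax, ∀ u : X₀ hp hk Ω, IsSolution h f u →
      energy p k (u : E N → ℝ) ≤ M := by
  obtain ⟨C, hC⟩ := hf
  have hp1 : 0 < p - 1 := by linarith
  -- Testing the equation with `u` gives `hmin n^p ≤ |C| n` for the norm `n`; `R` is the solution of
  -- `hmin R^(p - 1) = |C|`.
  set R : ℝ := (|C| / hmin) ^ (1 / (p - 1)) with hR
  have hR0 : 0 ≤ R := by positivity
  have hRp : R ^ (p - 1) = |C| / hmin := by
    rw [hR, ← Real.rpow_mul (by positivity), one_div_mul_cancel hp1.ne', Real.rpow_one]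
  refine ⟨ENNReal.ofReal (R ^ p), ENNReal.ofReal_ne_top, fun h hh u hu => ?_⟩
  have hfin : energy p k (u : E N → ℝ) ≠ ∞ := u.2.2.1.ne
  rw [← ENNReal.ofReal_toReal hfin, toReal_energy_eq hp]
  refine ENNReal.ofReal_le_ofReal
    (Real.rpow_le_rpow (normX₀_nonneg _ _ _) ?_ (by linarith))
  set n := normX₀ p k (u : E N → ℝ) with hn
  by_contra! hlt
  have hn0 : 0 < n := hR0.trans_lt hlt
  have h1 : hmin * n ^ p ≤ |C| * n := by
    calc hmin * n ^ p = ∫ z, hmin * |nonlocalGrad p k (u : E N → ℝ) z| ^ p := by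
          rw [integral_const_mul, (integral_grad_rpow u), toReal_energy_eq hp]
      _ ≤ ∫ z, h z * (signedPow p (nonlocalGrad p k (u : E N → ℝ) z)
            * nonlocalGrad p k (u : E N → ℝ) z) := by
          refine integral_mono_ae ((integrable_grad_rpow u).const_mul _)
            (integrable_coefficient_mul hmin_pos hh.1 hh.2.2 (integrable_pairing u u)) ?_
          filter_upwards [hh.2.2] with z hz
          rw [signedPow_mul_self hp]
          exact mul_le_mul_of_nonneg_right hz.1 (Real.rpow_nonneg (abs_nonneg _) _)
      _ = f u := by rw [← form_eq hp hk, hu u]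
      _ ≤ C * n := (le_abs_self _).trans (hC u)
      _ ≤ |C| * n := by gcongr; exact le_abs_self C
  have h2 : R ^ (p - 1) < n ^ (p - 1) := Real.rpow_lt_rpow hR0 hlt hp1
  rw [hRp, div_lt_iff₀ hmin_pos] at h2
  rw [← rpow_sub_one_mul_self hn0 p] at h1
  nlinarith

/-- The strips shrink to the diagonal, where the gradient is zero by convention, so continuity from
above of the integral suffices. -/
theorem tendsto_setIntegral_nearDiagonal (u : X₀ hp hk Ω) :
    Tendsto (fun n : ℕ => ∫ z in {z : E N × E N | 1 / ((n : ℝ) + 1) ≤ ‖z.1 - z.2‖}ᶜ,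
      |nonlocalGrad p k (u : E N → ℝ) z| ^ p) atTop (𝓝 0) := by
  have hS : ∀ n : ℕ, MeasurableSet {z : E N × E N | 1 / ((n : ℝ) + 1) ≤ ‖z.1 - z.2‖}ᶜ := fun n =>
    (isClosed_le continuous_const (continuous_fst.sub continuous_snd).norm).measurableSet.compl
  have hanti : Antitone fun n : ℕ => {z : E N × E N | 1 / ((n : ℝ) + 1) ≤ ‖z.1 - z.2‖}ᶜ := by
    intro n m hnm
    refine compl_subset_compl.2 fun z hz => ?_
    simp only [mem_ofPred_eq] at hz ⊢
    exact (Nat.one_div_le_one_div hnm).trans hz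
  have h := tendsto_setIntegral_of_antitone hS hanti ⟨0, (integrable_grad_rpow u).integrableOn⟩
  rwa [setIntegral_eq_zero_of_forall_eq_zero] at h
  intro z hz
  have hz0 : ‖z.1 - z.2‖ = 0 := by
    refine le_antisymm (le_of_forall_pos_lt_add fun ε hε => ?_) (norm_nonneg _)
    obtain ⟨n, hn⟩ := exists_nat_one_div_lt hε
    have := mem_iInter.1 hz n
    simp only [mem_compl_iff, mem_ofPred_eq, not_le] at this
    linarith
  rw [nonlocalGrad_of_norm_eq_zero p k _ hz0, abs_zero, Real.zero_rpow (by linarith)]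

/-- Off the diagonal the kernel is integrable, so the energy there is bounded by the `L^p` norm,
which tends to zero by compactness. -/
theorem tendsto_setIntegral_offDiagonal (hN : 0 < N) (hΩ : MeasurableSet Ω)
    (hΩb : Bornology.IsBounded Ω) {w : ℕ → X₀ hp hk Ω} (hw : TendstoWeaklyX₀ w 0) {M : ℝ≥0∞}
    (hM : M ≠ ∞) (hwM : ∀ j, energy p k (w j : E N → ℝ) ≤ M) {ε : ℝ} (hε : 0 < ε) :
    Tendsto (fun j => ∫ z in {z : E N × E N | ε ≤ ‖z.1 - z.2‖},
      |nonlocalGrad p k (w j : E N → ℝ) z| ^ p) atTop (𝓝 0) := by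
  have h1 := tendsto_powIntegral_zero hN hp hk hΩ hΩb hw hM hwM
  have h2 : Tendsto (fun j => 2 ^ p * (kernelTail N p k ε * powIntegral p (w j : E N → ℝ))) atTop
      (𝓝 0) := by
    have := ENNReal.Tendsto.const_mul (a := 2 ^ p) (ENNReal.Tendsto.const_mul h1
      (Or.inr (kernelTail_lt_top hk hε).ne))
      (Or.inr (ENNReal.rpow_ne_top_of_nonneg (by linarith) (by simp)))
    simpa using this
  have h3 := tendsto_of_tendsto_of_tendsto_of_le_of_le tendsto_const_nhds h2
    (fun _ => zero_le) (fun j => lintegral_offDiagonal_energyDensity_le hp hk (w j).2.1.1 ε)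
  have h4 := (ENNReal.tendsto_toReal ENNReal.zero_ne_top).comp h3
  refine h4.congr fun j => ?_
  rw [setIntegral_abs_nonlocalGrad_rpow hp hk (w j).2.1.1]
  rfl

/-- The pairing with a fixed function of `X₀` tends to zero in absolute value along weakly null
sequences. -/
theorem tendsto_integral_abs_pairing (hN : 0 < N) (hΩ : MeasurableSet Ω)
    (hΩb : Bornology.IsBounded Ω) (u : X₀ hp hk Ω) {w : ℕ → X₀ hp hk Ω}
    (hw : TendstoWeaklyX₀ w 0) {M : ℝ≥0∞} (hM : M ≠ ∞)
    (hwM : ∀ j, energy p k (w j : E N → ℝ) ≤ M) :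
    Tendsto (fun j => ∫ z, |signedPow p (nonlocalGrad p k (u : E N → ℝ) z)
      * nonlocalGrad p k (w j : E N → ℝ) z|) atTop (𝓝 0) := by
  set A := ∫ z, |nonlocalGrad p k (u : E N → ℝ) z| ^ p with hA
  have hA0 : 0 ≤ A := integral_nonneg fun z => Real.rpow_nonneg (abs_nonneg _) _
  have hK0 : 0 ≤ M.toReal := ENNReal.toReal_nonneg
  refine tendsto_zero_of_forall_le (fun j => integral_nonneg fun z => abs_nonneg _)
    fun η hη => ?_
  -- Budget for `η`: at most `η / 4` for the Young error on each of the two regions, and `η / 2` for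
  -- the mass of `u` near the diagonal.
  set η' := η / (4 * (A + M.toReal + 1)) with hη'
  have hη'0 : 0 < η' := by positivity
  have hη'le : η' * (A + M.toReal) ≤ η / 4 := by
    rw [hη', div_mul_eq_mul_div, div_le_div_iff₀ (by positivity) (by positivity)]
    nlinarith
  -- Near the diagonal the large constant must fall on the fixed `u`, away from it on `w j`; hence
  -- both forms of Young's inequality.
  obtain ⟨C₁, -, h₁⟩ := exists_signedPow_mul_le_left hp hη'0
  obtain ⟨C₂, -, h₂⟩ := exists_signedPow_mul_le_right hp hη'0
  have hT := (tendsto_setIntegral_nearDiagonal u).const_mul C₁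
  rw [mul_zero] at hT
  obtain ⟨n, hn⟩ := (hT.eventually_lt_const (half_pos hη)).exists
  set S := {z : E N × E N | 1 / ((n : ℝ) + 1) ≤ ‖z.1 - z.2‖} with hS
  have hSm : MeasurableSet S :=
    (isClosed_le continuous_const (continuous_fst.sub continuous_snd).norm).measurableSet
  have hr := (tendsto_setIntegral_offDiagonal hN hΩ hΩb hw hM hwM
    (Nat.one_div_pos_of_nat (n := n) (α := ℝ))).const_mul C₂
  rw [mul_zero] at hr
  refine ⟨_, hr, fun j => ?_⟩
  have hF := (integrable_pairing u (w j)).abs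
  have hX := (integrable_grad_rpow u).add (integrable_grad_rpow (w j))
  have hX0 : ∀ z, 0 ≤ |nonlocalGrad p k (u : E N → ℝ) z| ^ p
      + |nonlocalGrad p k (w j : E N → ℝ) z| ^ p := fun z =>
    add_nonneg (Real.rpow_nonneg (abs_nonneg _) _) (Real.rpow_nonneg (abs_nonneg _) _)
  have hXle : ∫ z, (|nonlocalGrad p k (u : E N → ℝ) z| ^ p
      + |nonlocalGrad p k (w j : E N → ℝ) z| ^ p) ≤ A + M.toReal := by
    rw [integral_add (integrable_grad_rpow u) (integrable_grad_rpow (w j))]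
    have := integral_grad_rpow_le (w j) hM (hwM j)
    linarith
  have i₁ := setIntegral_le_of_forall_le hη'0.le hF hX (integrable_grad_rpow u) hX0
    (fun z => h₁ _ _) Sᶜ
  have i₂ := setIntegral_le_of_forall_le hη'0.le hF hX (integrable_grad_rpow (w j)) hX0
    (fun z => h₂ _ _) S
  have i₃ := mul_le_mul_of_nonneg_left hXle hη'0.le
  rw [← integral_add_compl hSm hF]
  simp only [Pi.add_apply] at i₁ i₂
  linarith

theorem TendstoWeaklyX₀.sub_const {u : ℕ → X₀ hp hk Ω} {u₀ : X₀ hp hk Ω}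
    (h : TendstoWeaklyX₀ u u₀) : TendstoWeaklyX₀ (fun j => u j - u₀) 0 := by
  intro φ hφ
  have := (h φ hφ).sub_const (φ u₀)
  rw [sub_self] at this
  simpa using this

theorem TendstoStronglyX₀.tendstoWeakly {u : ℕ → X₀ hp hk Ω} {u₀ : X₀ hp hk Ω}
    (h : TendstoStronglyX₀ u u₀) : TendstoWeaklyX₀ u u₀ := by
  rintro φ ⟨C, hC⟩
  rw [tendsto_iff_norm_sub_tendsto_zero]
  have h' := Tendsto.const_mul C h
  rw [mul_zero] at h'
  refine squeeze_zero (fun _ => norm_nonneg _) (fun j => ?_) h'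
  rw [← map_sub]
  exact hC _

/-! ### From weak to strong convergence of solutions -/

/-- Weak convergence of solutions with a common right-hand side is strong. -/
theorem tendstoStrongly_of_tendstoWeakly (hN : 0 < N) (hΩ : MeasurableSet Ω)
    (hΩb : Bornology.IsBounded Ω) {hmin hmax : ℝ} (hmin_pos : 0 < hmin)
    {h : ℕ → E N × E N → ℝ} (hh : ∀ j, h j ∈ coefficients N hmin hmax)
    {f : X₀ hp hk Ω →ₗ[ℝ] ℝ} (hf : IsDual f) {u : ℕ → X₀ hp hk Ω} {u₀ : X₀ hp hk Ω}
    (hu : ∀ j, IsSolution (h j) f (u j)) (hweak : TendstoWeaklyX₀ u u₀) :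
    TendstoStronglyX₀ u u₀ := by
  obtain ⟨M, hM, hMle⟩ := exists_energy_le_of_isSolution (hmax := hmax) hmin_pos hf
  replace hMle : ∀ j, energy p k (u j : E N → ℝ) ≤ M := fun j => hMle _ (hh j) _ (hu j)
  have hw := hweak.sub_const
  set w : ℕ → X₀ hp hk Ω := fun j => u j - u₀ with hwdef
  have hgrad : ∀ j z, nonlocalGrad p k (w j : E N → ℝ) z
      = nonlocalGrad p k (u j : E N → ℝ) z - nonlocalGrad p k (u₀ : E N → ℝ) z :=
    fun j z => nonlocalGrad_sub p k _ _ z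
  set M' := ENNReal.ofReal (2 ^ p) * (M + energy p k (u₀ : E N → ℝ)) with hM'
  have hM't : M' ≠ ∞ :=
    ENNReal.mul_ne_top ENNReal.ofReal_ne_top (ENNReal.add_ne_top.2 ⟨hM, u₀.2.2.1.ne⟩)
  have hwM : ∀ j, energy p k (w j : E N → ℝ) ≤ M' := fun j =>
    (energy_sub_le hp hk (u j).2.1.1 _).trans (mul_le_mul_right (add_le_add_left (hMle j) _) _)
  have he := tendsto_integral_abs_pairing hN hΩ hΩb u₀ hw hM't hwM
  set e : ℕ → ℝ := fun j => ∫ z, |signedPow p (nonlocalGrad p k (u₀ : E N → ℝ) z)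
      * nonlocalGrad p k (w j : E N → ℝ) z| with hedef
  have hfw : Tendsto (fun j => f (w j)) atTop (𝓝 0) := by simpa using hw f hf
  have hs : Tendsto (fun j => (f (w j) + hmax * e j) / hmin) atTop (𝓝 0) := by
    simpa using (hfw.add (he.const_mul hmax)).div_const hmin
  have hmono : ∀ j, ∫ z, (signedPow p (nonlocalGrad p k (u j : E N → ℝ) z)
        - signedPow p (nonlocalGrad p k (u₀ : E N → ℝ) z))
        * nonlocalGrad p k (w j : E N → ℝ) z ≤ (f (w j) + hmax * e j) / hmin := by
    intro j
    have i₁ := integrable_pairing (u j) (w j)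
    have i₂ := integrable_pairing u₀ (w j)
    have i₃ := integrable_coefficient_mul hmin_pos (hh j).1 (hh j).2.2 i₁
    have i₄ := integrable_coefficient_mul hmin_pos (hh j).1 (hh j).2.2 i₂
    have hsol := hu j (w j)
    rw [form_eq hp hk] at hsol
    have habs := abs_integral_coefficient_mul_le hmin_pos (hh j).2.2 i₂
    rw [le_div_iff₀ hmin_pos, mul_comm, ← integral_const_mul]
    -- The monotone pairing is pointwise nonnegative, so `hmin` may be replaced by `h j z`. The
    -- equation then turns the `u j` part into `f (w j)`, leaving the pairing with the fixed `u₀`.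
    calc _ ≤ ∫ z, (h j z * (signedPow p (nonlocalGrad p k (u j : E N → ℝ) z)
              * nonlocalGrad p k (w j : E N → ℝ) z)
            - h j z * (signedPow p (nonlocalGrad p k (u₀ : E N → ℝ) z)
              * nonlocalGrad p k (w j : E N → ℝ) z)) := by
          refine integral_mono_ae ?_ (i₃.sub i₄) ?_
          · refine ((i₁.sub i₂).const_mul hmin).congr (Eventually.of_forall fun z => ?_)
            simp only [Pi.sub_apply, sub_mul]
          · filter_upwards [(hh j).2.2] with z hz
            rw [← mul_sub, ← sub_mul]
            refine mul_le_mul_of_nonneg_right hz.1 ?_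
            rw [hgrad]
            exact (signedPow_monotone_pairing hp _ _).1
      _ = f (w j) - ∫ z, h j z * (signedPow p (nonlocalGrad p k (u₀ : E N → ℝ) z)
              * nonlocalGrad p k (w j : E N → ℝ) z) := by rw [integral_sub i₃ i₄, hsol]
      _ ≤ _ := by linarith [neg_abs_le (∫ z, h j z
              * (signedPow p (nonlocalGrad p k (u₀ : E N → ℝ) z)
              * nonlocalGrad p k (w j : E N → ℝ) z))]
  have hEn : Tendsto (fun j => ∫ z, |nonlocalGrad p k (w j : E N → ℝ) z| ^ p) atTop (𝓝 0) := by
    refine tendsto_zero_of_forall_exists_const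
      (M := M.toReal + ∫ z, |nonlocalGrad p k (u₀ : E N → ℝ) z| ^ p)
      (fun j => integral_nonneg fun z => Real.rpow_nonneg (abs_nonneg _) _)
      (add_nonneg ENNReal.toReal_nonneg
        (integral_nonneg fun z => Real.rpow_nonneg (abs_nonneg _) _)) hs fun η hη => ?_
    -- Strong monotonicity up to an error `η (|a|^p + |b|^p)` treats all `p > 1` at once; the error
    -- is controlled by the uniform energy bound.
    obtain ⟨C, hC, hle⟩ := exists_abs_sub_rpow_le hp hη
    refine ⟨C, fun j => ?_⟩
    have i := setIntegral_le_of_forall_le (η := η) (C := C) hη.le (integrable_grad_rpow (w j))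
      ((integrable_grad_rpow (u j)).add (integrable_grad_rpow u₀))
      (Y := fun z => (signedPow p (nonlocalGrad p k (u j : E N → ℝ) z)
        - signedPow p (nonlocalGrad p k (u₀ : E N → ℝ) z)) * nonlocalGrad p k (w j : E N → ℝ) z)
      ((integrable_pairing (u j) (w j)).sub (integrable_pairing u₀ (w j)) |>.congr
        (Eventually.of_forall fun z => by simp only [Pi.sub_apply, sub_mul]))
      (fun z => add_nonneg (Real.rpow_nonneg (abs_nonneg _) _)
        (Real.rpow_nonneg (abs_nonneg _) _))
      (fun z => by rw [hgrad]; exact hle _ _) univ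
    simp only [setIntegral_univ, Pi.add_apply] at i
    rw [integral_add (integrable_grad_rpow (u j)) (integrable_grad_rpow u₀)] at i
    refine i.trans ?_
    have := integral_grad_rpow_le (u j) hM (hMle j)
    have := hmono j
    gcongr
  have hpow : Continuous fun t : ℝ => t ^ (1 / p) :=
    continuous_id.rpow_const fun _ => Or.inr (by positivity)
  have hlim := (hpow.tendsto 0).comp hEn
  have h1p : 1 / p ≠ 0 := by positivity
  simp only [Real.zero_rpow h1p] at hlim
  refine hlim.congr fun j => ?_
  simp only [Function.comp_apply]
  rw [(integral_grad_rpow (w j))]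
  rfl

/-! ### Weak convergence of the fluxes -/

/-- Strong convergence of solutions and weak-* convergence of the coefficients give weak
convergence of the fluxes. -/
theorem tendstoWeakly_flux {hmin hmax : ℝ} (hmin_pos : 0 < hmin)
    {h : ℕ → E N × E N → ℝ} {h₀ : E N × E N → ℝ} (hh : ∀ j, h j ∈ coefficients N hmin hmax)
    (hh₀ : h₀ ∈ coefficients N hmin hmax) (hstar : TendstoWeakStar h h₀)
    {u : ℕ → X₀ hp hk Ω} {u₀ : X₀ hp hk Ω} {M : ℝ≥0∞} (hM : M ≠ ∞)
    (hMle : ∀ j, energy p k (u j : E N → ℝ) ≤ M) (hu : TendstoStronglyX₀ u u₀) :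
    TendstoWeaklyLConj p (fun j => flux p k (h j) (u j)) (flux p k h₀ u₀) := by
  have hflux : ∀ (g : E N × E N → ℝ) (v : X₀ hp hk Ω), flux p k g (v : E N → ℝ)
      = fun z => g z * signedPow p (nonlocalGrad p k (v : E N → ℝ) z) := fun g v =>
    funext fun z => flux_eq hp hk g _ z
  have hmem : ∀ g ∈ coefficients N hmin hmax, ∀ v : X₀ hp hk Ω,
      MemLp (flux p k g (v : E N → ℝ)) (ENNReal.ofReal (p / (p - 1))) := by
    intro g hg v
    rw [hflux]
    have hv := memLp_signedPow hp (aestronglyMeasurable_grad v) (integrable_grad_rpow v)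
    refine hv.of_le_mul (c := hmax) (hg.1.mul hv.1) ?_
    filter_upwards [hg.2.2] with z hz
    rw [norm_mul, Real.norm_eq_abs, abs_of_nonneg (hmin_pos.le.trans hz.1)]
    exact mul_le_mul_of_nonneg_right hz.2 (norm_nonneg _)
  refine ⟨fun j => hmem _ (hh j) _, hmem _ hh₀ _, fun G hG => ?_⟩
  have hGi : Integrable (fun z => |G z| ^ p) := by
    have := hG.integrable_norm_rpow (by simpa using by linarith) ENNReal.ofReal_ne_top
    rwa [ENNReal.toReal_ofReal (by linarith)] at this
  have hpair : ∀ v : X₀ hp hk Ω, Integrable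
      (fun z => signedPow p (nonlocalGrad p k (v : E N → ℝ) z) * G z) := fun v =>
    integrable_signedPow_mul hp (aestronglyMeasurable_grad v) hG.1 (integrable_grad_rpow v) hGi
  have hsumi : Integrable (fun z => |nonlocalGrad p k (u₀ : E N → ℝ) z| ^ p + |G z| ^ p) :=
    (integrable_grad_rpow u₀).add hGi
  have hgrad : ∀ j z, nonlocalGrad p k ((u j - u₀ : X₀ hp hk Ω) : E N → ℝ) z
      = nonlocalGrad p k (u j : E N → ℝ) z - nonlocalGrad p k (u₀ : E N → ℝ) z :=
    fun j z => nonlocalGrad_sub p k _ _ z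
  have hEn : Tendsto (fun j => ∫ z,
      |nonlocalGrad p k ((u j - u₀ : X₀ hp hk Ω) : E N → ℝ) z| ^ p) atTop (𝓝 0) := by
    have hpow : Continuous fun t : ℝ => t ^ p :=
      continuous_id.rpow_const fun _ => Or.inr (by linarith)
    have hlim := (hpow.tendsto 0).comp hu
    simp only [Real.zero_rpow (by linarith : p ≠ 0)] at hlim
    refine hlim.congr fun j => ?_
    rw [(integral_grad_rpow (u j - u₀)), toReal_energy_eq hp]
    rfl
  have hdiff : Tendsto (fun j => ∫ z, |(signedPow p (nonlocalGrad p k (u j : E N → ℝ) z)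
      - signedPow p (nonlocalGrad p k (u₀ : E N → ℝ) z)) * G z|) atTop (𝓝 0) := by
    refine tendsto_zero_of_forall_exists_const
      (M := M.toReal + ((∫ z, |nonlocalGrad p k (u₀ : E N → ℝ) z| ^ p) + ∫ z, |G z| ^ p))
      (fun j => integral_nonneg fun z => abs_nonneg _)
      (add_nonneg ENNReal.toReal_nonneg (add_nonneg
        (integral_nonneg fun z => Real.rpow_nonneg (abs_nonneg _) _)
        (integral_nonneg fun z => Real.rpow_nonneg (abs_nonneg _) _))) hEn fun η hη => ?_
    obtain ⟨C, hC, hle⟩ := exists_signedPow_sub_mul_le hp hη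
    refine ⟨C, fun j => ?_⟩
    have i := setIntegral_le_of_forall_le (η := η) (C := C) hη.le
      (F := fun z => |(signedPow p (nonlocalGrad p k (u j : E N → ℝ) z)
        - signedPow p (nonlocalGrad p k (u₀ : E N → ℝ) z)) * G z|)
      (((hpair (u j)).sub (hpair u₀)).abs.congr
        (Eventually.of_forall fun z => by simp only [Pi.sub_apply, sub_mul]))
      ((integrable_grad_rpow (u j)).add hsumi)
      (integrable_grad_rpow (u j - u₀))
      (fun z => add_nonneg (Real.rpow_nonneg (abs_nonneg _) _)
        (add_nonneg (Real.rpow_nonneg (abs_nonneg _) _) (Real.rpow_nonneg (abs_nonneg _) _)))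
      (fun z => by rw [hgrad]; exact hle _ _ _) univ
    simp only [setIntegral_univ, Pi.add_apply] at i
    rw [integral_add (integrable_grad_rpow (u j)) hsumi,
      integral_add (integrable_grad_rpow u₀) hGi] at i
    refine i.trans ?_
    have := integral_grad_rpow_le (u j) hM (hMle j)
    gcongr
  have hmain : Tendsto (fun j => ∫ z, h j z * ((signedPow p (nonlocalGrad p k (u j : E N → ℝ) z)
      - signedPow p (nonlocalGrad p k (u₀ : E N → ℝ) z)) * G z)) atTop (𝓝 0) := by
    have hb := hdiff.const_mul hmax
    rw [mul_zero] at hb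
    refine squeeze_zero_norm (fun j => ?_) hb
    refine abs_integral_coefficient_mul_le hmin_pos (hh j).2.2 ?_
    exact ((hpair (u j)).sub (hpair u₀)).congr
      (Eventually.of_forall fun z => by simp only [Pi.sub_apply, sub_mul])
  -- The flux of `u j` is the `h j`-weighted difference of signed powers plus `h j` times the signed
  -- power of the fixed gradient of `u₀`. Only the second term uses weak-* convergence, with the
  -- integrable test function `σ(g_{u₀}) G`.
  have hsum := hmain.add (hstar _ (hpair u₀))
  rw [zero_add] at hsum
  simp only [hflux, mul_assoc]
  refine hsum.congr fun j => ?_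
  have i₁ := integrable_coefficient_mul hmin_pos (hh j).1 (hh j).2.2 (hpair (u j))
  have i₂ := integrable_coefficient_mul hmin_pos (hh j).1 (hh j).2.2 (hpair u₀)
  simp only [sub_mul, mul_sub]
  rw [integral_sub i₁ i₂, sub_add_cancel]

end Space

end

end NonlocalPLaplacian

theorem mainTheorem5 {N : ℕ} (hN : 0 < N) {p : ℝ} (hp : 1 < p)
    {k : ℝ → ℝ} (hk : IsKernel N p k)
    {Ω : Set (E N)} (hΩ : IsOpen Ω) (hΩb : Bornology.IsBounded Ω)
    {hmin hmax : ℝ} (hmin_pos : 0 < hmin) (hmin_lt : hmin < hmax)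
    {h : ℕ → E N × E N → ℝ} {h₀ : E N × E N → ℝ}
    (hh : ∀ j, h j ∈ coefficients N hmin hmax) (hh₀ : h₀ ∈ coefficients N hmin hmax) :
    -- weak convergence of solutions and fluxes gives strong convergence of the whole sequence
    (∀ f : X₀ hp hk Ω →ₗ[ℝ] ℝ, IsDual f →
      ∀ (u : ℕ → X₀ hp hk Ω) (u₀ : X₀ hp hk Ω),
        (∀ j, IsSolution (h j) f (u j)) → IsSolution h₀ f u₀ →
        TendstoWeaklyX₀ u u₀ →
        TendstoWeaklyLConj p (fun j => flux p k (h j) (u j)) (flux p k h₀ u₀) →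
        TendstoStronglyX₀ u u₀) ∧
    (HConverges hp hk Ω h h₀ → StrongGConverges hp hk Ω h h₀) ∧
    (GConverges hp hk Ω h h₀ ↔ StrongGConverges hp hk Ω h h₀) ∧
    -- the full equivalence, when `h₀` is the weak-* limit of the coefficients
    (TendstoWeakStar h h₀ →
      (HConverges hp hk Ω h h₀ ↔ StrongGConverges hp hk Ω h h₀) ∧
      (HConverges hp hk Ω h h₀ ↔ GConverges hp hk Ω h h₀)) := by
  have hstrong : ∀ f : X₀ hp hk Ω →ₗ[ℝ] ℝ, IsDual f →
      ∀ (u : ℕ → X₀ hp hk Ω) (u₀ : X₀ hp hk Ω), (∀ j, IsSolution (h j) f (u j)) →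
        TendstoWeaklyX₀ u u₀ → TendstoStronglyX₀ u u₀ := fun f hf u u₀ hu hw =>
    tendstoStrongly_of_tendstoWeakly hN hΩ.measurableSet hΩb hmin_pos hh hf hu hw
  have hHG : HConverges hp hk Ω h h₀ → GConverges hp hk Ω h h₀ :=
    fun H f hf u u₀ hu hu₀ => (H f hf u u₀ hu hu₀).1
  have hGS : GConverges hp hk Ω h h₀ ↔ StrongGConverges hp hk Ω h h₀ :=
    ⟨fun H f hf u u₀ hu hu₀ => hstrong f hf u u₀ hu (H f hf u u₀ hu hu₀),
      fun H f hf u u₀ hu hu₀ => (H f hf u u₀ hu hu₀).tendstoWeakly⟩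
  refine ⟨fun f hf u u₀ hu _ hw _ => hstrong f hf u u₀ hu hw, fun H => hGS.1 (hHG H), hGS,
    fun hstar => ?_⟩
  have hSH : StrongGConverges hp hk Ω h h₀ → HConverges hp hk Ω h h₀ := by
    intro H f hf u u₀ hu hu₀
    obtain ⟨M, hM, hMle⟩ := exists_energy_le_of_isSolution (hmax := hmax) hmin_pos hf
    have hs := H f hf u u₀ hu hu₀
    exact ⟨hs.tendstoWeakly, tendstoWeakly_flux hmin_pos hh hh₀ hstar hM
      (fun j => hMle _ (hh j) _ (hu j)) hs⟩
  exact ⟨⟨fun H => hGS.1 (hHG H), hSH⟩, ⟨hHG, fun H => hSH (hGS.1 H)⟩⟩
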